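/- For complex $a$ and $q$ with $|q|<1$ let $(a;q)_\infty=\prod_{i=0}^{\infty}(1-aq^i)$, and let $$\psi(q)=\frac{(q^2;q^2)_\infty}{(q;q^2)_\infty}$$ be Ramanujan's theta function. Then for every complex number $q$ with $|q|<1$ all the series below converge, and (a) $$\Big(\frac{\psi^3(q^3)}{\psi(q^9)}\Big)^2 =\Big(1+3\sum_{n=1}^{\infty}\Big(\frac{q^{18n-15}}{1-q^{18n-15}}-\frac{q^{18n-3}}{1-q^{18n-3}}\Big)\Big)^2 =1+3\sum_{n=1}^{\infty}\Big(\frac{q^{6n}}{(1-q^{6n})^2}+\frac{2q^{6n-3}}{(1-q^{6n-3})^2}-\frac{9q^{18n}}{(1-q^{18n})^2}\Big),$$ (b) $$\big(q\,\psi^4(q^2)\big)^2 =\Big(\sum_{n=1}^{\infty}\frac{(2n-1)q^{2n-1}}{1-q^{4n-2}}\Big)^2 =\sum_{n=1}^{\infty}\Big(\frac{6q^{8n-4}}{(1-q^{4n-2})^4}+\frac{q^{4n-2}}{(1-q^{4n-2})^2}\Big).$$ Here $\psi^k(x)$ denotes $(\psi(x))^k$. -/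

import Mathlib

/-- The finite `q`-shifted factorial `(a; q)_n = ∏_{i=0}^{n-1} (1 - a q^i)`. -/
noncomputable def qShifted (a q : ℂ) (n : ℕ) : ℂ :=
  ∏ i ∈ Finset.range n, (1 - a * q ^ i)

/-- The infinite `q`-shifted factorial `(a; q)_∞ = ∏_{i ≥ 0} (1 - a q^i)`; for `|q| < 1` it is the
limit of `(a; q)_n`, see `tendsto_qShifted`. -/
noncomputable def qShiftedInf (a q : ℂ) : ℂ :=
  ∏' i : ℕ, (1 - a * q ^ i)

/-- Ramanujan's theta function `ψ(q) = (q²; q²)_∞ / (q; q²)_∞`. -/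
noncomputable def ramanujanPsi (q : ℂ) : ℂ :=
  qShiftedInf (q ^ 2) (q ^ 2) / qShiftedInf q (q ^ 2)

theorem summable_norm_qShifted_term (a : ℂ) {q : ℂ} (hq : ‖q‖ < 1) :
    Summable fun i : ℕ => ‖-(a * q ^ i)‖ := by
  simpa only [norm_neg, norm_mul, norm_pow] using
    (summable_geometric_of_lt_one (norm_nonneg q) hq).mul_left ‖a‖

/-- For `|q| < 1` the infinite factorial is the limit of the finite ones. -/
theorem tendsto_qShifted (a : ℂ) {q : ℂ} (hq : ‖q‖ < 1) :
    Filter.Tendsto (qShifted a q) Filter.atTop (nhds (qShiftedInf a q)) := by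
  have h : Multipliable fun i : ℕ => 1 - a * q ^ i := by
    simpa only [sub_eq_add_neg] using
      multipliable_one_add_of_summable (summable_norm_qShifted_term a hq)
  exact h.hasProd.tendsto_prod_nat

theorem qShiftedInf_ne_zero {a q : ℂ} (ha : ‖a‖ < 1) (hq : ‖q‖ < 1) : qShiftedInf a q ≠ 0 := by
  have h := tprod_one_add_ne_zero_of_summable (f := fun i : ℕ => -(a * q ^ i)) ?_
    (summable_norm_qShifted_term a hq)
  · simpa only [qShiftedInf, sub_eq_add_neg] using h
  · intro i hi
    have h1 : a * q ^ i = 1 := by linear_combination -hi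
    have h2 : ‖a‖ * ‖q‖ ^ i = 1 := by rw [← norm_pow, ← norm_mul, h1, norm_one]
    have h3 : ‖q‖ ^ i ≤ 1 := pow_le_one₀ (norm_nonneg q) hq.le
    nlinarith [norm_nonneg a]

/-- On the open unit disc `ψ` has no zeros, and its denominator does not vanish; so the
quotients formed with these values are genuine quotients. -/
theorem ramanujanPsi_ne_zero {q : ℂ} (hq : ‖q‖ < 1) :
    qShiftedInf q (q ^ 2) ≠ 0 ∧ ramanujanPsi q ≠ 0 := by
  have h2 : ‖q ^ 2‖ < 1 := by
    rw [norm_pow]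
    exact pow_lt_one₀ (norm_nonneg q) hq two_ne_zero
  exact ⟨qShiftedInf_ne_zero hq h2,
    div_ne_zero (qShiftedInf_ne_zero h2 h2) (qShiftedInf_ne_zero hq h2)⟩

/-! The proof is the theory of elliptic functions on the torus ℂˣ / Q^ℤ. The sigma, zeta and ℘
functions become the theta product `qTheta`, the Lambert series `qZeta` (written ζ), which gains 1
under z ↦ Qz, and its Euler derivative `qWeierstrass` (written ℘). By Liouville, a multiplicatively
periodic function with only removable singularities is constant. This yields the four-term formula
`qZeta_add_add_sub`, which turns a sum of zeta values into a theta quotient, and the addition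
formula `qZeta_add_sub_sq`.

Part (a) takes x = q³ and Q = x⁶. The four-term formula at a = b = z = x evaluates 3ζ(x) − ζ(x³),
and ζ(x³) = 1/2 at the half period x³: the zeta side is the first Lambert series, the theta side is
ψ³(x)/ψ(x³). Its square is a linear combination of three instances of the addition formula
(`sq_one_add_lambert_eq`).

Part (b) takes Q = q⁴. Differentiating the four-term formula at a zero common to both sides gives
the product formula `qWeierstrass_sub` for ℘(a) − ℘(b). At a = q, b = −q the product is 2qψ⁴(q²),
while ℘(q) − ℘(−q) is twice the sum of m q^(mk) over odd m, k; summing over k first gives the first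
series (`hasSum_lambert_odd`). As a tends to the half period b = q², the product has a double zero,
and comparing second derivatives gives the second series (`orbitSum_geomSeries₃_eq`). -/

open Filter Topology

/-! ### Removable singularities and Liouville's theorem on ℂˣ / Q^ℤ -/

/-- `f` agrees near `z`, away from `z` itself, with a function analytic at `z`. -/
def HasRemovableSingularityAt (f : ℂ → ℂ) (z : ℂ) : Prop :=
  ∃ g, AnalyticAt ℂ g z ∧ f =ᶠ[𝓝[≠] z] g

theorem AnalyticAt.hasRemovableSingularityAt {f : ℂ → ℂ} {z : ℂ} (h : AnalyticAt ℂ f z) :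
    HasRemovableSingularityAt f z := ⟨f, h, EventuallyEq.rfl⟩

theorem tendsto_const_mul_punctured {Q : ℂ} (hQ : Q ≠ 0) (z : ℂ) :
    Tendsto (fun w => Q * w) (𝓝[≠] z) (𝓝[≠] (Q * z)) := by
  refine tendsto_nhdsWithin_iff.2 ⟨?_, ?_⟩
  · exact ((continuous_const.mul continuous_id).tendsto z).mono_left nhdsWithin_le_nhds
  · filter_upwards [self_mem_nhdsWithin] with w hw
    simpa [hQ] using hw

theorem tendsto_const_div_punctured {c z : ℂ} (hc : c ≠ 0) (hz : z ≠ 0) :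
    Tendsto (fun w => c / w) (𝓝[≠] z) (𝓝[≠] (c / z)) := by
  refine tendsto_nhdsWithin_iff.2 ⟨?_, ?_⟩
  · exact (ContinuousAt.div continuousAt_const continuousAt_id hz).mono_left nhdsWithin_le_nhds
  · filter_upwards [self_mem_nhdsWithin] with w hw h
    have hw' : w ≠ z := hw
    have h : c / w = c / z := h
    rcases eq_or_ne w 0 with rfl | h0
    · rw [div_zero] at h
      exact div_ne_zero hc hz h.symm
    · rw [div_eq_div_iff h0 hz] at h
      exact hw' (mul_left_cancel₀ hc h).symm

theorem HasRemovableSingularityAt.const_mul_arg {f : ℂ → ℂ} {Q z : ℂ} (hQ : Q ≠ 0)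
    (hper : ∀ᶠ w in 𝓝[≠] z, f (Q * w) = f w) (h : HasRemovableSingularityAt f z) :
    HasRemovableSingularityAt f (Q * z) := by
  obtain ⟨g, hg, hfg⟩ := h
  have hinv : Q⁻¹ * (Q * z) = z := by field_simp
  refine ⟨fun w => g (Q⁻¹ * w), ?_, ?_⟩
  · exact AnalyticAt.fun_comp (by rwa [hinv]) (by fun_prop)
  · have ht := tendsto_const_mul_punctured (inv_ne_zero hQ) (Q * z)
    rw [hinv] at ht
    filter_upwards [ht.eventually hfg, ht.eventually hper] with w h1 h2
    rw [← h1, ← h2]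
    congr 1
    field_simp

theorem HasRemovableSingularityAt.of_const_mul_arg {f : ℂ → ℂ} {Q z : ℂ} (hQ : Q ≠ 0)
    (hper : ∀ᶠ w in 𝓝[≠] z, f (Q * w) = f w) (h : HasRemovableSingularityAt f (Q * z)) :
    HasRemovableSingularityAt f z := by
  obtain ⟨g, hg, hfg⟩ := h
  refine ⟨fun w => g (Q * w), AnalyticAt.fun_comp hg (by fun_prop), ?_⟩
  filter_upwards [(tendsto_const_mul_punctured hQ z).eventually hfg, hper] with w h1 h2
  rw [← h1, h2]

theorem HasRemovableSingularityAt.of_const_div_arg {f : ℂ → ℂ} {c z : ℂ} (hc : c ≠ 0) (hz : z ≠ 0)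
    (hper : ∀ᶠ w in 𝓝[≠] z, f (c / w) = f w) (h : HasRemovableSingularityAt f (c / z)) :
    HasRemovableSingularityAt f z := by
  obtain ⟨g, hg, hfg⟩ := h
  refine ⟨fun w => g (c / w), AnalyticAt.fun_comp hg (analyticAt_const.div analyticAt_id hz), ?_⟩
  filter_upwards [(tendsto_const_div_punctured hc hz).eventually hfg, hper] with w h1 h2
  rw [← h1, h2]

theorem HasRemovableSingularityAt.zpow_mul {f : ℂ → ℂ} {Q : ℂ} (hQ : Q ≠ 0)
    (hper : ∀ z ≠ 0, ∀ᶠ w in 𝓝[≠] z, f (Q * w) = f w) {z : ℂ} (hz : z ≠ 0)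
    (h : HasRemovableSingularityAt f z) (n : ℤ) : HasRemovableSingularityAt f (Q ^ n * z) := by
  induction n with
  | zero => simpa using h
  | succ n ih =>
    have := ih.const_mul_arg hQ (hper _ (mul_ne_zero (zpow_ne_zero _ hQ) hz))
    rwa [← mul_assoc, ← zpow_one_add₀ hQ, add_comm] at this
  | pred n ih =>
    refine HasRemovableSingularityAt.of_const_mul_arg hQ
      (hper _ (mul_ne_zero (zpow_ne_zero _ hQ) hz)) ?_
    rw [← mul_assoc, ← zpow_one_add₀ hQ]
    convert ih using 3
    ring

/-- Division by a simple zero. -/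
theorem HasRemovableSingularityAt.of_simple_pole {f N : ℂ → ℂ} {α : ℂ} (hN : AnalyticAt ℂ N α)
    (h0 : N α = 0) (hf : ∀ᶠ w in 𝓝[≠] α, f w = N w / (α - w)) :
    HasRemovableSingularityAt f α := by
  refine ⟨fun w => - dslope N α w, ?_, ?_⟩
  · obtain ⟨s, hs, hd⟩ := hN.eventually_analyticAt.exists_mem
    have hd' : DifferentiableOn ℂ N s := fun w hw => (hd w hw).differentiableAt.differentiableWithinAt
    exact (((Complex.differentiableOn_dslope hs).2 hd').analyticAt hs).neg
  · filter_upwards [hf, self_mem_nhdsWithin] with w hw hne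
    rw [hw, dslope_of_ne _ hne, slope_def_field, h0, sub_zero, ← div_neg, neg_sub]

/-- The compact annulus ‖Q‖ ≤ ‖w‖ ≤ 1 contains a fundamental domain; this is what bounds a periodic
continuous function. -/
theorem exists_zpow_mul_norm_mem {Q z : ℂ} (hQ0 : Q ≠ 0) (hQ : ‖Q‖ < 1) (hz : z ≠ 0) :
    ∃ n : ℤ, ‖Q‖ ≤ ‖Q ^ n * z‖ ∧ ‖Q ^ n * z‖ ≤ 1 := by
  have hQ' : 0 < ‖Q‖ := norm_pos_iff.2 hQ0
  obtain ⟨n, h1, h2⟩ := exists_mem_Ico_zpow (norm_pos_iff.2 hz) ((one_lt_inv₀ hQ').2 hQ)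
  -- The base was ‖Q‖⁻¹ > 1, so ‖z‖ lies between ‖Q‖^(-n) and ‖Q‖^(-(n+1)); the larger exponent n +
  -- 1 brings it down to at most 1.
  refine ⟨n + 1, ?_, ?_⟩ <;> rw [norm_mul, norm_zpow] <;> rw [inv_zpow'] at h1 h2
  · calc ‖Q‖ = ‖Q‖ ^ (n + 1) * ‖Q‖ ^ (-n) := by rw [← zpow_add₀ hQ'.ne']; simp
      _ ≤ _ := by gcongr
  · calc ‖Q‖ ^ (n + 1) * ‖z‖ ≤ ‖Q‖ ^ (n + 1) * ‖Q‖ ^ (-(n + 1)) := by gcongr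
      _ = 1 := by rw [← zpow_add₀ hQ'.ne']; simp

/-- Liouville's theorem on the torus `ℂˣ / Q^ℤ`, with removable singularities. -/
theorem exists_tendsto_of_multiplicatively_periodic {Q : ℂ} (hQ0 : Q ≠ 0) (hQ : ‖Q‖ < 1)
    {f : ℂ → ℂ} (hper : ∀ z ≠ 0, ∀ᶠ w in 𝓝[≠] z, f (Q * w) = f w)
    (hloc : ∀ z ≠ 0, HasRemovableSingularityAt f z) :
    ∃ c, ∀ z ≠ 0, Tendsto f (𝓝[≠] z) (𝓝 c) := by
  -- The value of `f` at a removable singularity is arbitrary, so the argument runs on its punctured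
  -- limits.
  set F : ℂ → ℂ := fun z => limUnder (𝓝[≠] z) f with hF
  have hlim : ∀ z ≠ 0, Tendsto f (𝓝[≠] z) (𝓝 (F z)) := by
    intro z hz
    obtain ⟨g, hg, hfg⟩ := hloc z hz
    have : Tendsto f (𝓝[≠] z) (𝓝 (g z)) :=
      (hg.continuousAt.tendsto.mono_left nhdsWithin_le_nhds).congr' hfg.symm
    exact tendsto_nhds_limUnder ⟨_, this⟩
  have hdiff : ∀ z ≠ 0, DifferentiableAt ℂ F z := by
    intro z hz
    obtain ⟨g, hg, hfg⟩ := hloc z hz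
    have hev : ∀ᶠ w in 𝓝 z, f =ᶠ[𝓝[≠] w] g := by
      rw [EventuallyEq, eventually_nhdsWithin_iff] at hfg
      filter_upwards [hfg.eventually_nhds] with w hw
      rcases eq_or_ne w z with rfl | hwz
      · exact eventually_nhdsWithin_iff.2 hw
      · filter_upwards [mem_nhdsWithin_of_mem_nhds hw,
          mem_nhdsWithin_of_mem_nhds (isOpen_ne.mem_nhds hwz)] with y h1 h2 using h1 h2
    have : F =ᶠ[𝓝 z] g := by
      filter_upwards [hev, hg.eventually_analyticAt] with w h1 h2
      exact Tendsto.limUnder_eq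
        ((h2.continuousAt.tendsto.mono_left nhdsWithin_le_nhds).congr' h1.symm)
    exact hg.differentiableAt.congr_of_eventuallyEq this
  have hFper : ∀ z ≠ 0, F (Q * z) = F z := by
    intro z hz
    have h1 := (hlim _ (mul_ne_zero hQ0 hz)).comp (tendsto_const_mul_punctured hQ0 z)
    exact tendsto_nhds_unique (h1.congr' (hper z hz)) (hlim z hz)
  have hFz : ∀ z ≠ 0, ∀ n : ℤ, F (Q ^ n * z) = F z := by
    intro z hz n
    induction n with
    | zero => simp
    | succ n ih =>
      rw [add_comm, zpow_one_add₀ hQ0, mul_assoc,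
        hFper _ (mul_ne_zero (zpow_ne_zero _ hQ0) hz), ih]
    | pred n ih =>
      rw [← ih, ← hFper _ (mul_ne_zero (zpow_ne_zero _ hQ0) hz), ← mul_assoc,
        ← zpow_one_add₀ hQ0]
      congr 3
      ring
  set K : Set ℂ := {z | ‖Q‖ ≤ ‖z‖ ∧ ‖z‖ ≤ 1} with hK
  have hKc : IsCompact K := by
    refine (isCompact_closedBall (0 : ℂ) 1).of_isClosed_subset ?_ ?_
    · exact (isClosed_le continuous_const continuous_norm).inter
        (isClosed_le continuous_norm continuous_const)
    · intro z hz
      simpa using hz.2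
  have hK0 : ∀ z ∈ K, z ≠ 0 := by
    rintro z hz rfl
    have := hz.1
    simp at this
    exact hQ0 this
  have hcont : ContinuousOn F K := fun z hz => (hdiff z (hK0 z hz)).continuousAt.continuousWithinAt
  obtain ⟨M, hM⟩ := hKc.exists_bound_of_continuousOn hcont
  have hbound : ∀ z ≠ 0, ‖F z‖ ≤ M := by
    intro z hz
    obtain ⟨n, hn⟩ := exists_zpow_mul_norm_mem hQ0 hQ hz
    rw [← hFz z hz n]
    exact hM _ hn
  -- Pulling back along exp makes `F` an entire bounded function.
  have hent : Differentiable ℂ fun w => F (Complex.exp w) := fun w =>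
    (hdiff _ (Complex.exp_ne_zero w)).comp w Complex.differentiable_exp.differentiableAt
  have hbd : Bornology.IsBounded (Set.range fun w => F (Complex.exp w)) := by
    refine isBounded_iff_forall_norm_le.2 ⟨M, ?_⟩
    rintro _ ⟨w, rfl⟩
    exact hbound _ (Complex.exp_ne_zero w)
  refine ⟨F 1, fun z hz => ?_⟩
  have h := hent.apply_eq_apply_of_bounded hbd (Complex.log z) 0
  simp only [Complex.exp_log hz, Complex.exp_zero] at h
  rw [← h]
  exact hlim z hz

/-! ### Sums over half-orbits: convergence, derivatives, analyticity -/

/-- The sum of `g` over the half-orbit `z, zQ, zQ², …`. -/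
noncomputable def orbitSum (g : ℂ → ℂ) (Q z : ℂ) : ℂ := ∑' n : ℕ, g (z * Q ^ n)

/-- Since g(0) = 0, g(y)/y extends analytically to 0 and is bounded on a smaller closed disc. This
linear bound gives geometric domination of orbit sums. -/
theorem exists_norm_le_mul_norm {g : ℂ → ℂ} (hg : DifferentiableOn ℂ g (Metric.ball 0 1))
    (h0 : g 0 = 0) {r : ℝ} (hr : r < 1) : ∃ C, 0 ≤ C ∧ ∀ y, ‖y‖ ≤ r → ‖g y‖ ≤ C * ‖y‖ := by
  have hd : DifferentiableOn ℂ (dslope g 0) (Metric.ball 0 1) :=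
    (Complex.differentiableOn_dslope (Metric.ball_mem_nhds _ one_pos)).2 hg
  have hsub : Metric.closedBall (0 : ℂ) r ⊆ Metric.ball 0 1 := Metric.closedBall_subset_ball hr
  obtain ⟨C, hC⟩ := (isCompact_closedBall (0 : ℂ) r).exists_bound_of_continuousOn
    (hd.continuousOn.mono hsub)
  refine ⟨max C 0, le_max_right _ _, fun y hy => ?_⟩
  have h1 := hC y (by simpa using hy)
  have h2 : g y = y * dslope g 0 y := by
    have := sub_smul_dslope g 0 y
    simp [h0] at this
    exact this.symm
  rw [h2, norm_mul, mul_comm]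
  gcongr
  exact h1.trans (le_max_left _ _)

section
variable {g : ℂ → ℂ} {Q : ℂ}

theorem tendsto_mul_pow_zero (hQ : ‖Q‖ < 1) (z : ℂ) :
    Tendsto (fun n : ℕ => z * Q ^ n) atTop (𝓝 0) := by
  simpa using (tendsto_pow_atTop_nhds_zero_of_norm_lt_one hQ).const_mul z

theorem summable_norm_orbitSum (hg : DifferentiableOn ℂ g (Metric.ball 0 1)) (h0 : g 0 = 0)
    (hQ : ‖Q‖ < 1) (z : ℂ) : Summable fun n : ℕ => ‖g (z * Q ^ n)‖ := by
  obtain ⟨C, hC0, hC⟩ := exists_norm_le_mul_norm hg h0 (r := 1 / 2) (by norm_num)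
  have hs : Summable fun n : ℕ => C * (‖z‖ * ‖Q‖ ^ n) :=
    ((summable_geometric_of_lt_one (norm_nonneg Q) hQ).mul_left _).mul_left _
  refine Summable.of_norm_bounded_eventually_nat hs ?_
  have := (tendsto_mul_pow_zero hQ z).eventually
    (Metric.closedBall_mem_nhds (0 : ℂ) (by norm_num : (0 : ℝ) < 1 / 2))
  filter_upwards [this] with n hn
  have := hC _ (mem_closedBall_zero_iff.1 hn)
  rw [norm_mul, norm_pow] at this
  rwa [norm_norm]

theorem summable_orbitSum (hg : DifferentiableOn ℂ g (Metric.ball 0 1)) (h0 : g 0 = 0)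
    (hQ : ‖Q‖ < 1) (z : ℂ) : Summable fun n : ℕ => g (z * Q ^ n) :=
  (summable_norm_orbitSum hg h0 hQ z).of_norm

theorem orbitSum_eq_add (hg : DifferentiableOn ℂ g (Metric.ball 0 1)) (h0 : g 0 = 0)
    (hQ : ‖Q‖ < 1) (z : ℂ) : orbitSum g Q z = g z + orbitSum g Q (Q * z) := by
  unfold orbitSum
  rw [(summable_orbitSum hg h0 hQ z).tsum_eq_zero_add]
  simp only [pow_zero, mul_one, pow_succ]
  congr 2
  ext n
  ring_nf

theorem norm_mul_pow_le (hQ : ‖Q‖ < 1) (z : ℂ) (n : ℕ) : ‖z * Q ^ n‖ ≤ ‖z‖ := by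
  rw [norm_mul, norm_pow]
  exact mul_le_of_le_one_right (norm_nonneg _) (pow_le_one₀ (norm_nonneg _) hQ.le)

theorem hasDerivAt_orbitSum (hg : DifferentiableOn ℂ g (Metric.ball 0 1)) (h0 : g 0 = 0)
    (hQ : ‖Q‖ < 1) {z : ℂ} (hz : ‖z‖ < 1) :
    HasDerivAt (orbitSum g Q) (∑' n : ℕ, Q ^ n * deriv g (z * Q ^ n)) z := by
  obtain ⟨r, hzr, hr⟩ := exists_between hz
  obtain ⟨C, hC0, hC⟩ := exists_norm_le_mul_norm hg h0 hr
  have hs : Summable fun n : ℕ => C * (r * ‖Q‖ ^ n) :=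
    ((summable_geometric_of_lt_one (norm_nonneg Q) hQ).mul_left _).mul_left _
  have hmem : ∀ w ∈ Metric.ball (0 : ℂ) r, ∀ n : ℕ, w * Q ^ n ∈ Metric.ball (0 : ℂ) 1 := by
    intro w hw n
    have hw : ‖w‖ < r := by simpa using hw
    simpa using (norm_mul_pow_le hQ w n).trans_lt (hw.trans hr)
  have hdiff : ∀ n : ℕ, DifferentiableOn ℂ (fun w => g (w * Q ^ n)) (Metric.ball 0 r) := by
    intro n
    exact hg.comp (by fun_prop) (fun w hw => hmem w hw n)
  have hbd : ∀ (n : ℕ) (w : ℂ), w ∈ Metric.ball (0 : ℂ) r → ‖g (w * Q ^ n)‖ ≤ C * (r * ‖Q‖ ^ n) := by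
    intro n w hw
    have hw : ‖w‖ < r := by simpa using hw
    refine (hC _ ((norm_mul_pow_le hQ w n).trans hw.le)).trans ?_
    rw [norm_mul, norm_pow]
    gcongr
  have hzm : z ∈ Metric.ball (0 : ℂ) r := by simpa using hzr
  have hD := Complex.differentiableOn_tsum_of_summable_norm hs hdiff Metric.isOpen_ball hbd
  have hS := Complex.hasSum_deriv_of_summable_norm hs hdiff Metric.isOpen_ball hbd hzm
  have h := (hD.differentiableAt (Metric.isOpen_ball.mem_nhds hzm)).hasDerivAt
  rw [← hS.tsum_eq] at h
  have he : ∀ n : ℕ, deriv (fun w => g (w * Q ^ n)) z = Q ^ n * deriv g (z * Q ^ n) := by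
    intro n
    have h1 : HasDerivAt g (deriv g (z * Q ^ n)) (z * Q ^ n) :=
      (hg.differentiableAt (Metric.isOpen_ball.mem_nhds (hmem z hzm n))).hasDerivAt
    have h2 : HasDerivAt (fun w : ℂ => w * Q ^ n) (Q ^ n) z := by
      simpa using (hasDerivAt_id z).mul_const (Q ^ n)
    have h3 : HasDerivAt (fun w => g (w * Q ^ n)) (deriv g (z * Q ^ n) * Q ^ n) z := h1.comp z h2
    rw [h3.deriv, mul_comm]
  simp only [he] at h
  exact h

/-- Termwise application of the Euler operator `z d/dz`. -/
theorem hasDerivAt_orbitSum_of_euler {g' : ℂ → ℂ} (hg : DifferentiableOn ℂ g (Metric.ball 0 1))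
    (h0 : g 0 = 0) (hQ : ‖Q‖ < 1) (hg' : ∀ y ∈ Metric.ball (0 : ℂ) 1, y * deriv g y = g' y)
    {z : ℂ} (hz : ‖z‖ < 1) (hz0 : z ≠ 0) :
    HasDerivAt (orbitSum g Q) (orbitSum g' Q z / z) z := by
  convert hasDerivAt_orbitSum hg h0 hQ hz using 1
  unfold orbitSum
  rw [← tsum_div_const]
  congr 1
  ext n
  rw [← hg' _ (by simpa using (norm_mul_pow_le hQ z n).trans_lt hz)]
  field_simp

theorem analyticAt_orbitSum_of_norm_lt (hg : DifferentiableOn ℂ g (Metric.ball 0 1)) (h0 : g 0 = 0)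
    (hQ : ‖Q‖ < 1) {z : ℂ} (hz : ‖z‖ < 1) : AnalyticAt ℂ (orbitSum g Q) z := by
  have hd : DifferentiableOn ℂ (orbitSum g Q) (Metric.ball 0 1) := fun w hw =>
    (hasDerivAt_orbitSum hg h0 hQ (by simpa using hw)).differentiableAt.differentiableWithinAt
  exact hd.analyticAt (Metric.isOpen_ball.mem_nhds (by simpa using hz))

/-- The orbit enters the unit disc after finitely many steps. There the sum is analytic by
domination, and each earlier term is peeled off with `orbitSum_eq_add`. -/
theorem analyticAt_orbitSum (hg : DifferentiableOn ℂ g {1}ᶜ) (h0 : g 0 = 0)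
    (hQ : ‖Q‖ < 1) {z : ℂ} (hz : ∀ n : ℕ, z * Q ^ n ≠ 1) : AnalyticAt ℂ (orbitSum g Q) z := by
  have hball : DifferentiableOn ℂ g (Metric.ball 0 1) := hg.mono (by
    rintro w hw rfl
    simp at hw)
  have key : ∀ (N : ℕ) (z : ℂ), (∀ n : ℕ, z * Q ^ n ≠ 1) → ‖z * Q ^ N‖ < 1 →
      AnalyticAt ℂ (orbitSum g Q) z := by
    intro N
    induction N with
    | zero => intro z _ h2; exact analyticAt_orbitSum_of_norm_lt hball h0 hQ (by simpa using h2)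
    | succ N ih =>
      intro z h1 h2
      have e : orbitSum g Q = fun w => g w + orbitSum g Q (Q * w) :=
        funext (orbitSum_eq_add hball h0 hQ)
      rw [e]
      have hz1 : z ≠ 1 := by simpa using h1 0
      refine (hg.analyticAt (isOpen_compl_singleton.mem_nhds hz1)).add ?_
      refine AnalyticAt.fun_comp (ih (Q * z) (fun n => ?_) ?_) (by fun_prop)
      · convert h1 (n + 1) using 1
        ring
      · convert h2 using 2
        ring
  have hev := (tendsto_mul_pow_zero hQ z).eventually (Metric.ball_mem_nhds (0 : ℂ) one_pos)
  obtain ⟨N, hN⟩ := hev.exists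
  exact key N z hz (by simpa using hN)

theorem orbitSum_at_zero (h0 : g 0 = 0) : orbitSum g Q 0 = 0 := by simp [orbitSum, h0]

end

/-! ### The infinite factorial as an entire function of its first argument, and its zeros -/

section
variable {Q : ℂ}

theorem qShiftedInf_eq_mul (hQ : ‖Q‖ < 1) (z : ℂ) :
    qShiftedInf z Q = (1 - z) * qShiftedInf (Q * z) Q := by
  have h1 := (tendsto_qShifted z hQ).comp (tendsto_add_atTop_nat 1)
  have h2 := (tendsto_qShifted (Q * z) hQ).const_mul (1 - z)
  refine tendsto_nhds_unique h1 (h2.congr fun n => ?_)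
  simp only [qShifted, Function.comp, Finset.prod_range_succ']
  rw [mul_comm]
  congr 1
  · refine Finset.prod_congr rfl fun i _ => ?_
    ring
  · simp

theorem ne_one_of_qShiftedInf_ne_zero (hQ : ‖Q‖ < 1) {z : ℂ} (h : qShiftedInf z Q ≠ 0) (n : ℕ) :
    z * Q ^ n ≠ 1 := by
  induction n generalizing z with
  | zero =>
    intro h1
    rw [qShiftedInf_eq_mul hQ] at h
    simp_all
  | succ n ih =>
    rw [qShiftedInf_eq_mul hQ] at h
    have := ih (right_ne_zero_of_mul h)
    convert this using 1
    ring

theorem exists_of_qShiftedInf_eq_zero (hQ : ‖Q‖ < 1) {z : ℂ} (h : qShiftedInf z Q = 0) :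
    ∃ n : ℕ, z * Q ^ n = 1 := by
  have key : ∀ (N : ℕ) (z : ℂ), qShiftedInf z Q = 0 → ‖z * Q ^ N‖ < 1 →
      ∃ n : ℕ, z * Q ^ n = 1 := by
    intro N
    induction N with
    | zero => intro z h1 h2; exact absurd h1 (qShiftedInf_ne_zero (by simpa using h2) hQ)
    | succ N ih =>
      intro z h1 h2
      rw [qShiftedInf_eq_mul hQ, mul_eq_zero] at h1
      rcases h1 with h1 | h1
      · exact ⟨0, by linear_combination -h1⟩
      · obtain ⟨n, hn⟩ := ih _ h1 (by convert h2 using 2; ring)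
        exact ⟨n + 1, by rw [← hn]; ring⟩
  have hev := (tendsto_mul_pow_zero hQ z).eventually (Metric.ball_mem_nhds (0 : ℂ) one_pos)
  obtain ⟨N, hN⟩ := hev.exists
  exact key N z h (by simpa using hN)

theorem differentiable_qShiftedInf (hQ : ‖Q‖ < 1) : Differentiable ℂ fun z => qShiftedInf z Q := by
  have hd : ∀ r : ℝ, 0 < r → DifferentiableOn ℂ (fun z => qShiftedInf z Q) (Metric.ball 0 r) := by
    intro r hr
    have hs : Summable fun n : ℕ => r * ‖Q‖ ^ n :=
      (summable_geometric_of_lt_one (norm_nonneg Q) hQ).mul_left _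
    have hp := hs.hasProdLocallyUniformlyOn_nat_one_add (f := fun (n : ℕ) (z : ℂ) => -(z * Q ^ n))
      (K := Metric.ball (0 : ℂ) r) Metric.isOpen_ball
      (.of_forall fun n z hz => by
        have hz : ‖z‖ < r := by simpa using hz
        rw [norm_neg, norm_mul, norm_pow]
        gcongr) (fun n => by fun_prop)
    have := hp.differentiableOn (.of_forall fun s => by
      simpa [Finset.prod_fn] using DifferentiableOn.finsetProd (fun _ _ => by fun_prop))
      Metric.isOpen_ball
    simpa only [qShiftedInf, sub_eq_add_neg] using this
  intro z
  exact (hd (‖z‖ + 1) (by positivity)).differentiableAt (Metric.isOpen_ball.mem_nhds (by simp))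

theorem analyticAt_qShiftedInf (hQ : ‖Q‖ < 1) (z : ℂ) : AnalyticAt ℂ (fun w => qShiftedInf w Q) z :=
  (differentiable_qShiftedInf hQ).analyticAt z

end

/-! ### The rational functions summing k^j y^k -/

/-- `y / (1 - y) = ∑ y ^ k`. -/
noncomputable def geomSeries₀ (y : ℂ) : ℂ := y / (1 - y)
/-- `y / (1 - y) ^ 2 = ∑ k y ^ k`. -/
noncomputable def geomSeries₁ (y : ℂ) : ℂ := y / (1 - y) ^ 2
/-- `y (1 + y) / (1 - y) ^ 3 = ∑ k ^ 2 y ^ k`. -/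
noncomputable def geomSeries₂ (y : ℂ) : ℂ := y * (1 + y) / (1 - y) ^ 3
/-- `y (1 + 4 y + y ^ 2) / (1 - y) ^ 4 = ∑ k ^ 3 y ^ k`. -/
noncomputable def geomSeries₃ (y : ℂ) : ℂ := y * (1 + 4 * y + y ^ 2) / (1 - y) ^ 4

@[simp] theorem geomSeries₀_zero : geomSeries₀ 0 = 0 := by simp [geomSeries₀]
@[simp] theorem geomSeries₁_zero : geomSeries₁ 0 = 0 := by simp [geomSeries₁]
@[simp] theorem geomSeries₂_zero : geomSeries₂ 0 = 0 := by simp [geomSeries₂]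
@[simp] theorem geomSeries₃_zero : geomSeries₃ 0 = 0 := by simp [geomSeries₃]

theorem ball_subset_compl_one : Metric.ball (0 : ℂ) 1 ⊆ {1}ᶜ := by
  rintro w hw rfl
  simp at hw

theorem hasDerivAt_geomSeries₀ {y : ℂ} (hy : y ≠ 1) :
    HasDerivAt geomSeries₀ (1 / (1 - y) ^ 2) y := by
  have h1 : 1 - y ≠ 0 := sub_ne_zero.2 hy.symm
  have hd : HasDerivAt (fun y : ℂ => 1 - y) (-1) y := by simpa using (hasDerivAt_id y).const_sub 1
  have h2 : HasDerivAt (fun y : ℂ => y / (1 - y)) _ y := (hasDerivAt_id' y).fun_div hd h1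
  exact h2.congr_deriv (by ring)

theorem hasDerivAt_geomSeries₁ {y : ℂ} (hy : y ≠ 1) :
    HasDerivAt geomSeries₁ ((1 + y) / (1 - y) ^ 3) y := by
  have h1 : 1 - y ≠ 0 := sub_ne_zero.2 hy.symm
  have hd : HasDerivAt (fun y : ℂ => 1 - y) (-1) y := by simpa using (hasDerivAt_id y).const_sub 1
  have h2 : HasDerivAt (fun y : ℂ => y / (1 - y) ^ 2) _ y :=
    (hasDerivAt_id' y).fun_div (hd.fun_pow 2) (pow_ne_zero 2 h1)
  refine h2.congr_deriv ?_
  field_simp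
  ring

theorem hasDerivAt_geomSeries₂ {y : ℂ} (hy : y ≠ 1) :
    HasDerivAt geomSeries₂ ((1 + 4 * y + y ^ 2) / (1 - y) ^ 4) y := by
  have h1 : 1 - y ≠ 0 := sub_ne_zero.2 hy.symm
  have hd : HasDerivAt (fun y : ℂ => 1 - y) (-1) y := by simpa using (hasDerivAt_id y).const_sub 1
  have hn : HasDerivAt (fun y : ℂ => y * (1 + y)) (1 * (1 + y) + y * 1) y :=
    (hasDerivAt_id y).mul ((hasDerivAt_id y).const_add 1)
  have h2 : HasDerivAt (fun y : ℂ => y * (1 + y) / (1 - y) ^ 3) _ y :=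
    hn.fun_div (hd.fun_pow 3) (pow_ne_zero 3 h1)
  refine h2.congr_deriv ?_
  field_simp
  ring

theorem differentiableOn_geomSeries₀ : DifferentiableOn ℂ geomSeries₀ {1}ᶜ := fun _ hy =>
  (hasDerivAt_geomSeries₀ hy).differentiableAt.differentiableWithinAt
theorem differentiableOn_geomSeries₁ : DifferentiableOn ℂ geomSeries₁ {1}ᶜ := fun _ hy =>
  (hasDerivAt_geomSeries₁ hy).differentiableAt.differentiableWithinAt
theorem differentiableOn_geomSeries₂ : DifferentiableOn ℂ geomSeries₂ {1}ᶜ := fun _ hy =>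
  (hasDerivAt_geomSeries₂ hy).differentiableAt.differentiableWithinAt
theorem differentiableOn_geomSeries₃ : DifferentiableOn ℂ geomSeries₃ {1}ᶜ := fun y hy => by
  have h1 : 1 - y ≠ 0 := sub_ne_zero.2 (Ne.symm hy)
  have : DifferentiableAt ℂ (fun y : ℂ => y * (1 + 4 * y + y ^ 2) / (1 - y) ^ 4) y :=
    DifferentiableAt.div (by fun_prop) (by fun_prop) (pow_ne_zero 4 h1)
  exact this.differentiableWithinAt

theorem mul_deriv_geomSeries₀ {y : ℂ} (hy : y ∈ Metric.ball (0 : ℂ) 1) :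
    y * deriv geomSeries₀ y = geomSeries₁ y := by
  rw [(hasDerivAt_geomSeries₀ (ball_subset_compl_one hy)).deriv, geomSeries₁]; ring
theorem mul_deriv_geomSeries₁ {y : ℂ} (hy : y ∈ Metric.ball (0 : ℂ) 1) :
    y * deriv geomSeries₁ y = geomSeries₂ y := by
  rw [(hasDerivAt_geomSeries₁ (ball_subset_compl_one hy)).deriv, geomSeries₂]; ring
theorem mul_deriv_geomSeries₂ {y : ℂ} (hy : y ∈ Metric.ball (0 : ℂ) 1) :
    y * deriv geomSeries₂ y = geomSeries₃ y := by
  rw [(hasDerivAt_geomSeries₂ (ball_subset_compl_one hy)).deriv, geomSeries₃]; ring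

theorem geomSeries₀_inv {z : ℂ} (h0 : z ≠ 0) (h1 : z ≠ 1) :
    geomSeries₀ (1 / z) = -1 - geomSeries₀ z := by
  have h2 : 1 - z ≠ 0 := sub_ne_zero.2 h1.symm
  have h3 : z - 1 ≠ 0 := sub_ne_zero.2 h1
  have h4 : 1 - 1 / z ≠ 0 := by
    rw [show 1 - 1 / z = (z - 1) / z by field_simp]
    exact div_ne_zero h3 h0
  unfold geomSeries₀
  field_simp
  ring

theorem geomSeries₁_inv {z : ℂ} (h0 : z ≠ 0) : geomSeries₁ (1 / z) = geomSeries₁ z := by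
  rcases eq_or_ne z 1 with rfl | h1
  · simp
  have h2 : 1 - z ≠ 0 := sub_ne_zero.2 h1.symm
  have h3 : z - 1 ≠ 0 := sub_ne_zero.2 h1
  unfold geomSeries₁
  rw [show 1 - 1 / z = (z - 1) / z by field_simp]
  field_simp
  ring

/-! ### Theta, zeta and ℘ in multiplicative form -/

section
variable {Q : ℂ}

/-- The theta function `(z; Q)_∞ (Q / z; Q)_∞`. -/
noncomputable def qTheta (Q z : ℂ) : ℂ := qShiftedInf z Q * qShiftedInf (Q / z) Q

/-- The odd quasi-periodic function `1/2 - z Θ'(z) / Θ(z)`, the analogue of Weierstrass' `ζ`. -/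
noncomputable def qZeta (Q z : ℂ) : ℂ :=
  1 / 2 + orbitSum geomSeries₀ Q z - orbitSum geomSeries₀ Q (Q / z)

/-- The regular part of `qZeta` at `1`. -/
noncomputable def qZetaReg (Q z : ℂ) : ℂ :=
  -(1 / 2) + orbitSum geomSeries₀ Q (Q * z) - orbitSum geomSeries₀ Q (Q / z)

/-- The Euler derivative of `qZeta`, the analogue of Weierstrass' `℘`. -/
noncomputable def qWeierstrass (Q z : ℂ) : ℂ :=
  orbitSum geomSeries₁ Q z + orbitSum geomSeries₁ Q (Q / z)

/-- The regular part of `qWeierstrass` at `1`. -/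
noncomputable def qWeierstrassReg (Q z : ℂ) : ℂ :=
  orbitSum geomSeries₁ Q (Q * z) + orbitSum geomSeries₁ Q (Q / z)

theorem orbitSum_geomSeries₀_eq (hQ : ‖Q‖ < 1) (z : ℂ) :
    orbitSum geomSeries₀ Q z = geomSeries₀ z + orbitSum geomSeries₀ Q (Q * z) :=
  orbitSum_eq_add (differentiableOn_geomSeries₀.mono ball_subset_compl_one) geomSeries₀_zero hQ z

theorem orbitSum_geomSeries₁_eq (hQ : ‖Q‖ < 1) (z : ℂ) :
    orbitSum geomSeries₁ Q z = geomSeries₁ z + orbitSum geomSeries₁ Q (Q * z) :=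
  orbitSum_eq_add (differentiableOn_geomSeries₁.mono ball_subset_compl_one) geomSeries₁_zero hQ z

theorem qTheta_eq_mul (hQ : ‖Q‖ < 1) (z : ℂ) :
    qTheta Q z = (1 - z) * (qShiftedInf (Q * z) Q * qShiftedInf (Q / z) Q) := by
  rw [qTheta, qShiftedInf_eq_mul hQ z, mul_assoc]

theorem qTheta_one (hQ : ‖Q‖ < 1) : qTheta Q 1 = 0 := by
  rw [qTheta_eq_mul hQ]; simp

theorem qTheta_inv (hQ : ‖Q‖ < 1) {z : ℂ} (hz : z ≠ 0) : qTheta Q (1 / z) = -qTheta Q z / z := by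
  rw [qTheta_eq_mul hQ, qTheta_eq_mul hQ]
  simp only [mul_one_div, div_div_eq_mul_div, div_one]
  field_simp
  ring

theorem qTheta_mul (hQ0 : Q ≠ 0) (hQ : ‖Q‖ < 1) {z : ℂ} (hz : z ≠ 0) :
    qTheta Q (Q * z) = -qTheta Q z / z := by
  rw [qTheta, show Q / (Q * z) = 1 / z by field_simp, qShiftedInf_eq_mul hQ (1 / z),
    qTheta_eq_mul hQ, mul_one_div]
  field_simp
  ring

theorem qTheta_inv_ne_zero (hQ : ‖Q‖ < 1) {z : ℂ} (hz : z ≠ 0) (h : qTheta Q z ≠ 0) :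
    qTheta Q (1 / z) ≠ 0 := by
  rw [qTheta_inv hQ hz]
  exact div_ne_zero (neg_ne_zero.2 h) hz

theorem qTheta_ne_zero_of_norm (hQ : ‖Q‖ < 1) {z : ℂ} (h1 : ‖Q‖ < ‖z‖) (h2 : ‖z‖ < 1) :
    qTheta Q z ≠ 0 := by
  have hz : 0 < ‖z‖ := (norm_nonneg Q).trans_lt h1
  refine mul_ne_zero (qShiftedInf_ne_zero h2 hQ) (qShiftedInf_ne_zero ?_ hQ)
  rwa [norm_div, div_lt_one hz]

theorem exists_zpow_of_qTheta_eq_zero (hQ0 : Q ≠ 0) (hQ : ‖Q‖ < 1) {z : ℂ} (hz : z ≠ 0)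
    (h : qTheta Q z = 0) : ∃ n : ℤ, z = Q ^ n := by
  rcases mul_eq_zero.1 h with h | h
  · obtain ⟨n, hn⟩ := exists_of_qShiftedInf_eq_zero hQ h
    exact ⟨-n, by rw [zpow_neg, zpow_natCast]; exact eq_inv_of_mul_eq_one_left hn⟩
  · obtain ⟨n, hn⟩ := exists_of_qShiftedInf_eq_zero hQ h
    refine ⟨n + 1, ?_⟩
    rw [zpow_add_one₀ hQ0, zpow_natCast]
    field_simp at hn
    rw [← hn]
    ring

theorem analyticAt_qTheta (hQ : ‖Q‖ < 1) {z : ℂ} (hz : z ≠ 0) : AnalyticAt ℂ (qTheta Q) z :=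
  (analyticAt_qShiftedInf hQ z).mul
    (AnalyticAt.fun_comp (analyticAt_qShiftedInf hQ (Q / z))
      (analyticAt_const.div analyticAt_id hz))

/-- Otherwise the identity theorem on the connected set ℂˣ would make theta vanish identically, but
it is nonzero at a real point strictly between ‖Q‖ and 1. -/
theorem eventually_qTheta_ne_zero (hQ0 : Q ≠ 0) (hQ : ‖Q‖ < 1) {z : ℂ} (hz : z ≠ 0) :
    ∀ᶠ w in 𝓝[≠] z, qTheta Q w ≠ 0 := by
  by_contra hcon
  have hfreq : ∃ᶠ w in 𝓝[≠] z, qTheta Q w = 0 :=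
    (not_eventually.1 hcon).mono fun _ => not_not.1
  have hpc : IsPreconnected ({0}ᶜ : Set ℂ) :=
    (isConnected_compl_singleton_of_one_lt_rank (by simp) 0).isPreconnected
  have hA : AnalyticOnNhd ℂ (qTheta Q) {0}ᶜ := fun w hw => analyticAt_qTheta hQ hw
  have h := hA.eqOn_zero_of_preconnected_of_frequently_eq_zero hpc hz hfreq
  have hQ' : 0 < ‖Q‖ := norm_pos_iff.2 hQ0
  obtain ⟨r, hr1, hr2⟩ := exists_between hQ
  have hr : ‖(r : ℂ)‖ = r := by
    rw [Complex.norm_real, Real.norm_of_nonneg (hQ'.trans hr1).le]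
  refine qTheta_ne_zero_of_norm (z := (r : ℂ)) hQ (by rwa [hr]) (by rwa [hr]) (h ?_)
  simpa using (hQ'.trans hr1).ne'

theorem ne_one_of_qTheta_ne_zero (hQ : ‖Q‖ < 1) {z : ℂ} (h : qTheta Q z ≠ 0) : z ≠ 1 := by
  rintro rfl
  exact h (qTheta_one hQ)

theorem qZeta_eq (hQ : ‖Q‖ < 1) {z : ℂ} (h1 : z ≠ 1) :
    qZeta Q z = 1 / (1 - z) + qZetaReg Q z := by
  have h2 : 1 - z ≠ 0 := sub_ne_zero.2 h1.symm
  rw [qZeta, qZetaReg, orbitSum_geomSeries₀_eq hQ z, geomSeries₀]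
  field_simp
  ring

theorem qZeta_inv (hQ : ‖Q‖ < 1) {z : ℂ} (hz : z ≠ 0) (h1 : z ≠ 1) :
    qZeta Q (1 / z) = -qZeta Q z := by
  rw [qZeta, qZeta, orbitSum_geomSeries₀_eq hQ z, orbitSum_geomSeries₀_eq hQ (1 / z),
    geomSeries₀_inv hz h1, mul_one_div, div_div_eq_mul_div, div_one]
  ring

/-- The quasi-period does not depend on z, so differences such as ζ(z) − ζ(cz) are genuinely
periodic. -/
theorem qZeta_mul (hQ0 : Q ≠ 0) (hQ : ‖Q‖ < 1) {z : ℂ} (hz : z ≠ 0) (h1 : z ≠ 1) :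
    qZeta Q (Q * z) = qZeta Q z + 1 := by
  rw [qZeta, qZeta, show Q / (Q * z) = 1 / z by field_simp, orbitSum_geomSeries₀_eq hQ z,
    orbitSum_geomSeries₀_eq hQ (1 / z), geomSeries₀_inv hz h1, mul_one_div]
  ring

theorem qZeta_div (hQ0 : Q ≠ 0) (z : ℂ) : qZeta Q (Q / z) = 1 - qZeta Q z := by
  rw [qZeta, qZeta, div_div_cancel₀ hQ0]
  ring

theorem qWeierstrass_eq (hQ : ‖Q‖ < 1) (z : ℂ) :
    qWeierstrass Q z = z / (1 - z) ^ 2 + qWeierstrassReg Q z := by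
  rw [qWeierstrass, qWeierstrassReg, orbitSum_geomSeries₁_eq hQ z, geomSeries₁]
  ring

theorem qWeierstrass_inv (hQ : ‖Q‖ < 1) {z : ℂ} (hz : z ≠ 0) :
    qWeierstrass Q (1 / z) = qWeierstrass Q z := by
  rw [qWeierstrass, qWeierstrass, orbitSum_geomSeries₁_eq hQ z, orbitSum_geomSeries₁_eq hQ (1 / z),
    geomSeries₁_inv hz, mul_one_div, div_div_eq_mul_div, div_one]
  ring

theorem qWeierstrass_mul (hQ0 : Q ≠ 0) (hQ : ‖Q‖ < 1) {z : ℂ} (hz : z ≠ 0) :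
    qWeierstrass Q (Q * z) = qWeierstrass Q z := by
  rw [qWeierstrass, qWeierstrass, show Q / (Q * z) = 1 / z by field_simp,
    orbitSum_geomSeries₁_eq hQ z, orbitSum_geomSeries₁_eq hQ (1 / z), geomSeries₁_inv hz, mul_one_div]
  ring

theorem qWeierstrass_div (hQ0 : Q ≠ 0) (z : ℂ) : qWeierstrass Q (Q / z) = qWeierstrass Q z := by
  rw [qWeierstrass, qWeierstrass, div_div_cancel₀ hQ0]
  ring

theorem analyticAt_orbitSum_div {g : ℂ → ℂ} (hg : DifferentiableOn ℂ g {1}ᶜ) (h0 : g 0 = 0)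
    (hQ : ‖Q‖ < 1) {z : ℂ} (hz : z ≠ 0) (h : ∀ n : ℕ, Q / z * Q ^ n ≠ 1) :
    AnalyticAt ℂ (fun w => orbitSum g Q (Q / w)) z :=
  AnalyticAt.fun_comp (analyticAt_orbitSum hg h0 hQ h) (analyticAt_const.div analyticAt_id hz)

theorem analyticAt_qZeta (hQ : ‖Q‖ < 1) {z : ℂ} (hz : z ≠ 0) (h : qTheta Q z ≠ 0) :
    AnalyticAt ℂ (qZeta Q) z :=
  (analyticAt_const.add (analyticAt_orbitSum differentiableOn_geomSeries₀ geomSeries₀_zero hQ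
    (ne_one_of_qShiftedInf_ne_zero hQ (left_ne_zero_of_mul h)))).sub
    (analyticAt_orbitSum_div differentiableOn_geomSeries₀ geomSeries₀_zero hQ hz
    (ne_one_of_qShiftedInf_ne_zero hQ (right_ne_zero_of_mul h)))

theorem analyticAt_qWeierstrass (hQ : ‖Q‖ < 1) {z : ℂ} (hz : z ≠ 0) (h : qTheta Q z ≠ 0) :
    AnalyticAt ℂ (qWeierstrass Q) z :=
  (analyticAt_orbitSum differentiableOn_geomSeries₁ geomSeries₁_zero hQ
    (ne_one_of_qShiftedInf_ne_zero hQ (left_ne_zero_of_mul h))).add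
    (analyticAt_orbitSum_div differentiableOn_geomSeries₁ geomSeries₁_zero hQ hz
    (ne_one_of_qShiftedInf_ne_zero hQ (right_ne_zero_of_mul h)))

/-- The bound on z keeps Q/z in the unit disc, where termwise differentiation applies; inversion
reverses the Euler operator, whence the sign. -/
theorem hasDerivAt_orbitSum_div {g g' : ℂ → ℂ} (hg : DifferentiableOn ℂ g {1}ᶜ)
    (h0 : g 0 = 0) (hQ : ‖Q‖ < 1) (hQ0 : Q ≠ 0)
    (hg' : ∀ {y : ℂ}, y ∈ Metric.ball (0 : ℂ) 1 → y * deriv g y = g' y)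
    {z : ℂ} (hz : ‖Q‖ < ‖z‖) :
    HasDerivAt (fun w => orbitSum g Q (Q / w)) (-orbitSum g' Q (Q / z) / z) z := by
  have hz' : 0 < ‖z‖ := (norm_nonneg Q).trans_lt hz
  have hz0 : z ≠ 0 := norm_pos_iff.1 hz'
  have h1 := hasDerivAt_orbitSum_of_euler (hg.mono ball_subset_compl_one) h0 hQ (fun _ => hg')
    (z := Q / z) (by rwa [norm_div, div_lt_one hz']) (div_ne_zero hQ0 hz0)
  have h2 : HasDerivAt (fun w => Q / w) (-Q / z ^ 2) z := by
    exact ((hasDerivAt_const z Q).fun_div (hasDerivAt_id' z) hz0).congr_deriv (by ring)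
  have h3 := h1.comp z h2
  refine h3.congr_deriv ?_
  field_simp

theorem hasDerivAt_qZeta (hQ0 : Q ≠ 0) (hQ : ‖Q‖ < 1) {z : ℂ} (h1 : ‖Q‖ < ‖z‖) (h2 : ‖z‖ < 1) :
    HasDerivAt (qZeta Q) (qWeierstrass Q z / z) z := by
  have hz0 : z ≠ 0 := norm_pos_iff.1 ((norm_nonneg Q).trans_lt h1)
  have ha := hasDerivAt_orbitSum_of_euler (differentiableOn_geomSeries₀.mono ball_subset_compl_one)
    geomSeries₀_zero hQ (fun _ => mul_deriv_geomSeries₀) h2 hz0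
  have hb := hasDerivAt_orbitSum_div differentiableOn_geomSeries₀ geomSeries₀_zero hQ hQ0
    mul_deriv_geomSeries₀ h1
  refine ((ha.const_add (1 / 2)).sub hb).congr_deriv ?_
  rw [qWeierstrass]
  ring

theorem hasDerivAt_qWeierstrass (hQ0 : Q ≠ 0) (hQ : ‖Q‖ < 1) {z : ℂ} (h1 : ‖Q‖ < ‖z‖)
    (h2 : ‖z‖ < 1) : HasDerivAt (qWeierstrass Q)
      ((orbitSum geomSeries₂ Q z - orbitSum geomSeries₂ Q (Q / z)) / z) z := by
  have hz0 : z ≠ 0 := norm_pos_iff.1 ((norm_nonneg Q).trans_lt h1)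
  have ha := hasDerivAt_orbitSum_of_euler (differentiableOn_geomSeries₁.mono ball_subset_compl_one)
    geomSeries₁_zero hQ (fun _ => mul_deriv_geomSeries₁) h2 hz0
  have hb := hasDerivAt_orbitSum_div differentiableOn_geomSeries₁ geomSeries₁_zero hQ hQ0
    mul_deriv_geomSeries₁ h1
  refine (ha.add hb).congr_deriv ?_
  ring

/-- Both half-orbits contribute the same sum, the Eisenstein-type constant that reappears in the
addition formula. -/
theorem hasDerivAt_qZetaReg_one (hQ0 : Q ≠ 0) (hQ : ‖Q‖ < 1) :
    HasDerivAt (qZetaReg Q) (2 * orbitSum geomSeries₁ Q Q) 1 := by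
  have ha := hasDerivAt_orbitSum_of_euler (differentiableOn_geomSeries₀.mono ball_subset_compl_one)
    geomSeries₀_zero hQ (fun _ => mul_deriv_geomSeries₀) (z := Q * 1) (by simpa) (by simpa)
  have hb := hasDerivAt_orbitSum_div differentiableOn_geomSeries₀ geomSeries₀_zero hQ hQ0
    mul_deriv_geomSeries₀ (z := 1) (by simpa)
  have hc : HasDerivAt (fun w => Q * w) Q 1 := by simpa using (hasDerivAt_id (1 : ℂ)).const_mul Q
  refine (((ha.comp 1 hc).const_add (-(1 / 2))).sub hb).congr_deriv ?_
  simp only [mul_one, div_one]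
  field_simp
  ring

theorem qZetaReg_one : qZetaReg Q 1 = -(1 / 2) := by simp [qZetaReg]

theorem qWeierstrassReg_one : qWeierstrassReg Q 1 = 2 * orbitSum geomSeries₁ Q Q := by
  simp [qWeierstrassReg]; ring

theorem self_mul_pow_ne_one (hQ : ‖Q‖ < 1) (n : ℕ) : Q * Q ^ n ≠ 1 := by
  intro h
  have := norm_mul_pow_le hQ Q n
  rw [h, norm_one] at this
  linarith

theorem analyticAt_orbitSum_mul_one {g : ℂ → ℂ} (hg : DifferentiableOn ℂ g {1}ᶜ) (h0 : g 0 = 0)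
    (hQ : ‖Q‖ < 1) : AnalyticAt ℂ (fun w => orbitSum g Q (Q * w)) 1 :=
  AnalyticAt.fun_comp (analyticAt_orbitSum hg h0 hQ (by simpa using self_mul_pow_ne_one hQ))
    (by fun_prop)

theorem analyticAt_qZetaReg_one (hQ : ‖Q‖ < 1) : AnalyticAt ℂ (qZetaReg Q) 1 :=
  (analyticAt_const.add
    (analyticAt_orbitSum_mul_one differentiableOn_geomSeries₀ geomSeries₀_zero hQ)).sub
    (analyticAt_orbitSum_div differentiableOn_geomSeries₀ geomSeries₀_zero hQ one_ne_zero
      (by simpa using self_mul_pow_ne_one hQ))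

theorem analyticAt_qWeierstrassReg_one (hQ : ‖Q‖ < 1) : AnalyticAt ℂ (qWeierstrassReg Q) 1 :=
  (analyticAt_orbitSum_mul_one differentiableOn_geomSeries₁ geomSeries₁_zero hQ).add
    (analyticAt_orbitSum_div differentiableOn_geomSeries₁ geomSeries₁_zero hQ one_ne_zero
      (by simpa using self_mul_pow_ne_one hQ))

end

/-! ### Identities proved by Liouville's theorem -/

section
variable {Q : ℂ}

theorem eventually_ne_zero_punctured {z : ℂ} (hz : z ≠ 0) : ∀ᶠ w in 𝓝[≠] z, w ≠ 0 :=
  (isOpen_ne.eventually_mem hz).filter_mono nhdsWithin_le_nhds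

theorem eventually_qTheta_const_mul_ne_zero (hQ0 : Q ≠ 0) (hQ : ‖Q‖ < 1) {c z : ℂ} (hc : c ≠ 0)
    (hz : z ≠ 0) : ∀ᶠ w in 𝓝[≠] z, qTheta Q (c * w) ≠ 0 :=
  (tendsto_const_mul_punctured hc z).eventually (eventually_qTheta_ne_zero hQ0 hQ (mul_ne_zero hc hz))

/-- An elliptic function that is invariant under `z ↦ 1 / (c z)` and regular outside the orbits of
`1` and `1 / c` is constant as soon as its singularity at `1` is removable. -/
theorem exists_tendsto_of_elliptic_symmetric (hQ0 : Q ≠ 0) (hQ : ‖Q‖ < 1) {f : ℂ → ℂ} {c : ℂ}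
    (hc : c ≠ 0)
    (hper : ∀ w ≠ 0, qTheta Q w ≠ 0 → qTheta Q (c * w) ≠ 0 → f (Q * w) = f w)
    (hsymm : ∀ w ≠ 0, qTheta Q w ≠ 0 → qTheta Q (c * w) ≠ 0 → f (1 / c / w) = f w)
    (hreg : ∀ w ≠ 0, qTheta Q w ≠ 0 → qTheta Q (c * w) ≠ 0 → AnalyticAt ℂ f w)
    (h1 : HasRemovableSingularityAt f 1) :
    ∃ k, ∀ z ≠ 0, Tendsto f (𝓝[≠] z) (𝓝 k) := by
  have hev : ∀ z ≠ 0, ∀ᶠ w in 𝓝[≠] z, f (Q * w) = f w := by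
    intro z hz
    filter_upwards [eventually_ne_zero_punctured hz, eventually_qTheta_ne_zero hQ0 hQ hz,
      eventually_qTheta_const_mul_ne_zero hQ0 hQ hc hz] with w h1 h2 h3 using hper w h1 h2 h3
  have hzpow : ∀ n : ℤ, HasRemovableSingularityAt f (Q ^ n) := by
    intro n
    simpa using h1.zpow_mul hQ0 hev one_ne_zero n
  refine exists_tendsto_of_multiplicatively_periodic hQ0 hQ hev fun z hz => ?_
  by_cases hz1 : qTheta Q z = 0
  · obtain ⟨n, rfl⟩ := exists_zpow_of_qTheta_eq_zero hQ0 hQ hz hz1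
    exact hzpow n
  -- The symmetry exchanges the orbits of 1 and 1/c, so removability is transported from the former
  -- to the latter.
  by_cases hz2 : qTheta Q (c * z) = 0
  · obtain ⟨n, hn⟩ := exists_zpow_of_qTheta_eq_zero hQ0 hQ (mul_ne_zero hc hz) hz2
    refine HasRemovableSingularityAt.of_const_div_arg (c := 1 / c) (one_div_ne_zero hc) hz ?_ ?_
    · filter_upwards [eventually_ne_zero_punctured hz, eventually_qTheta_ne_zero hQ0 hQ hz,
        eventually_qTheta_const_mul_ne_zero hQ0 hQ hc hz] with w h1 h2 h3 using hsymm w h1 h2 h3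
    · rw [div_div, hn, one_div, ← zpow_neg]
      exact hzpow _
  · exact (hreg z hz hz1 hz2).hasRemovableSingularityAt

theorem qShiftedInf_self_ne_zero (hQ : ‖Q‖ < 1) : qShiftedInf Q Q ≠ 0 := qShiftedInf_ne_zero hQ hQ

theorem analyticAt_comp_const_mul {g : ℂ → ℂ} {c z : ℂ} (h : AnalyticAt ℂ g (c * z)) :
    AnalyticAt ℂ (fun w => g (c * w)) z := AnalyticAt.fun_comp h (by fun_prop)

/-- The four-term identity: a sum of values of `qZeta` as a quotient of theta functions. -/
theorem qZeta_add_add_sub (hQ0 : Q ≠ 0) (hQ : ‖Q‖ < 1) {a b z : ℂ} (ha : a ≠ 0) (hb : b ≠ 0)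
    (hz : z ≠ 0) (hta : qTheta Q a ≠ 0) (htb : qTheta Q b ≠ 0) (htab : qTheta Q (a * b) ≠ 0)
    (htz : qTheta Q z ≠ 0) (htabz : qTheta Q (a * b * z) ≠ 0) :
    qZeta Q a + qZeta Q b + qZeta Q z - qZeta Q (a * b * z) =
      qShiftedInf Q Q ^ 2 * qTheta Q (a * b) / (qTheta Q a * qTheta Q b) *
        (qTheta Q (b * z) * qTheta Q (a * z)) / (qTheta Q z * qTheta Q (a * b * z)) := by
  set M := qShiftedInf Q Q ^ 2 * qTheta Q (a * b) / (qTheta Q a * qTheta Q b) with hM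
  set f : ℂ → ℂ := fun z => qZeta Q a + qZeta Q b + qZeta Q z - qZeta Q (a * b * z) -
    M * (qTheta Q (b * z) * qTheta Q (a * z)) / (qTheta Q z * qTheta Q (a * b * z)) with hf
  have hab : a * b ≠ 0 := mul_ne_zero ha hb
  have hφ := qShiftedInf_self_ne_zero hQ
  have hreg : ∀ w ≠ 0, qTheta Q w ≠ 0 → qTheta Q (a * b * w) ≠ 0 → AnalyticAt ℂ f w := by
    intro w hw h1 h2
    refine AnalyticAt.sub (AnalyticAt.sub (analyticAt_const.add (analyticAt_qZeta hQ hw h1))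
      (analyticAt_comp_const_mul (analyticAt_qZeta hQ (mul_ne_zero hab hw) h2)))
      (AnalyticAt.div (analyticAt_const.mul (AnalyticAt.mul ?_ ?_)) (AnalyticAt.mul ?_ ?_) ?_)
    · exact analyticAt_comp_const_mul (analyticAt_qTheta hQ (mul_ne_zero hb hw))
    · exact analyticAt_comp_const_mul (analyticAt_qTheta hQ (mul_ne_zero ha hw))
    · exact analyticAt_qTheta hQ hw
    · exact analyticAt_comp_const_mul (analyticAt_qTheta hQ (mul_ne_zero hab hw))
    · exact mul_ne_zero h1 h2
  have hk : ∃ k, ∀ z ≠ 0, Tendsto f (𝓝[≠] z) (𝓝 k) := by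
    refine exists_tendsto_of_elliptic_symmetric hQ0 hQ hab ?_ ?_ hreg ?_
    · intro w hw h1 h2
      simp only [hf, mul_left_comm _ Q]
      rw [qZeta_mul hQ0 hQ hw (ne_one_of_qTheta_ne_zero hQ h1),
        qZeta_mul hQ0 hQ (mul_ne_zero hab hw) (ne_one_of_qTheta_ne_zero hQ h2),
        qTheta_mul hQ0 hQ hw, qTheta_mul hQ0 hQ (mul_ne_zero hab hw),
        qTheta_mul hQ0 hQ (mul_ne_zero ha hw), qTheta_mul hQ0 hQ (mul_ne_zero hb hw)]
      field_simp
      ring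
    · intro w hw h1 h2
      simp only [hf]
      rw [show a * b * (1 / (a * b) / w) = 1 / w by field_simp,
        show b * (1 / (a * b) / w) = 1 / (a * w) by field_simp,
        show a * (1 / (a * b) / w) = 1 / (b * w) by field_simp,
        show 1 / (a * b) / w = 1 / (a * b * w) by field_simp,
        qZeta_inv hQ hw (ne_one_of_qTheta_ne_zero hQ h1),
        qZeta_inv hQ (mul_ne_zero hab hw) (ne_one_of_qTheta_ne_zero hQ h2),
        qTheta_inv hQ hw, qTheta_inv hQ (mul_ne_zero hab hw),
        qTheta_inv hQ (mul_ne_zero ha hw), qTheta_inv hQ (mul_ne_zero hb hw)]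
      field_simp
      ring
    · refine HasRemovableSingularityAt.of_simple_pole (N := fun z =>
        1 + (1 - z) * (qZeta Q a + qZeta Q b + qZetaReg Q z - qZeta Q (a * b * z)) -
        M * (qTheta Q (b * z) * qTheta Q (a * z)) /
          (qShiftedInf (Q * z) Q * qShiftedInf (Q / z) Q * qTheta Q (a * b * z))) ?_ ?_ ?_
      · refine AnalyticAt.sub (analyticAt_const.add (AnalyticAt.mul (by fun_prop)
          (AnalyticAt.sub (analyticAt_const.add (analyticAt_qZetaReg_one hQ))
            (analyticAt_comp_const_mul (analyticAt_qZeta hQ (by simpa using hab) (by simpa)))))) ?_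
        refine AnalyticAt.div (analyticAt_const.mul (AnalyticAt.mul ?_ ?_))
          (AnalyticAt.mul (AnalyticAt.mul ?_ ?_) ?_) ?_
        · exact analyticAt_comp_const_mul (analyticAt_qTheta hQ (by simpa))
        · exact analyticAt_comp_const_mul (analyticAt_qTheta hQ (by simpa))
        · exact analyticAt_comp_const_mul (g := fun w => qShiftedInf w Q)
            (analyticAt_qShiftedInf hQ _)
        · exact AnalyticAt.fun_comp (g := fun w => qShiftedInf w Q) (analyticAt_qShiftedInf hQ _)
            (analyticAt_const.div analyticAt_id one_ne_zero)
        · exact analyticAt_comp_const_mul (analyticAt_qTheta hQ (by simpa using hab))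
        · simpa using ⟨hφ, htab⟩
      -- Cancellation of residues at 1: this is what fixes the constant `M`.
      · simp only [sub_self, zero_mul, add_zero, mul_one, div_one, hM]
        field_simp
        ring
      · filter_upwards [eventually_qTheta_ne_zero hQ0 hQ one_ne_zero] with w h2
        have h1 : w ≠ 1 := ne_one_of_qTheta_ne_zero hQ h2
        have h3 : 1 - w ≠ 0 := sub_ne_zero.2 h1.symm
        simp only [hf]
        rw [qTheta_eq_mul hQ w] at h2 ⊢
        rw [qZeta_eq hQ h1, sub_div, add_div, mul_div_cancel_left₀ _ h3, div_div]
        ring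
  obtain ⟨k, hk⟩ := hk
  have hval : ∀ w ≠ 0, qTheta Q w ≠ 0 → qTheta Q (a * b * w) ≠ 0 → f w = k := by
    intro w hw h1 h2
    exact tendsto_nhds_unique
      ((hreg w hw h1 h2).continuousAt.tendsto.mono_left nhdsWithin_le_nhds) (hk w hw)
  -- The constant is evaluated at z = 1/a, where the zeta terms cancel in pairs by oddness and the
  -- factor theta(az) = theta(1) vanishes.
  have hfa : f (1 / a) = 0 := by
    simp only [hf]
    rw [show a * b * (1 / a) = b by field_simp, mul_one_div_cancel ha, qTheta_one hQ,
      qZeta_inv hQ ha (ne_one_of_qTheta_ne_zero hQ hta)]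
    ring
  have hk0 : k = 0 := by
    rw [← hfa, hval (1 / a) (one_div_ne_zero ha) (qTheta_inv_ne_zero hQ ha hta)]
    rwa [show a * b * (1 / a) = b by field_simp]
  have := hval z hz htz htabz
  rw [hk0] at this
  exact sub_eq_zero.1 this

/-- The difference of two values of `qWeierstrass` as a quotient of theta functions. -/
theorem qWeierstrass_sub (hQ0 : Q ≠ 0) (hQ : ‖Q‖ < 1) {a b : ℂ} (ha : ‖Q‖ < ‖a‖) (ha1 : ‖a‖ < 1)
    (hb : ‖Q‖ < ‖b‖) (hb1 : ‖b‖ < 1) (htab : qTheta Q (a * b) ≠ 0) :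
    qWeierstrass Q a - qWeierstrass Q b = -b * qShiftedInf Q Q ^ 4 *
      (qTheta Q (a * b) * qTheta Q (a / b)) / (qTheta Q a ^ 2 * qTheta Q b ^ 2) := by
  have ha0 : a ≠ 0 := norm_pos_iff.1 ((norm_nonneg Q).trans_lt ha)
  have hb0 : b ≠ 0 := norm_pos_iff.1 ((norm_nonneg Q).trans_lt hb)
  have hta := qTheta_ne_zero_of_norm hQ ha ha1
  have htb := qTheta_ne_zero_of_norm hQ hb hb1
  have hab : a * b ≠ 0 := mul_ne_zero ha0 hb0
  have hib : (1 / b) ≠ 0 := one_div_ne_zero hb0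
  have eab : a * b * (1 / b) = a := by field_simp
  have htib : qTheta Q (1 / b) ≠ 0 := qTheta_inv_ne_zero hQ hb0 htb
  set M := qShiftedInf Q Q ^ 2 * qTheta Q (a * b) / (qTheta Q a * qTheta Q b) with hM
  set R : ℂ → ℂ := fun z => M * (qShiftedInf (Q * (b * z)) Q * qShiftedInf (Q / (b * z)) Q *
    qTheta Q (a * z)) / (qTheta Q z * qTheta Q (a * b * z)) with hR
  have hRa : AnalyticAt ℂ R (1 / b) := by
    refine AnalyticAt.div (analyticAt_const.mul (AnalyticAt.mul (AnalyticAt.mul ?_ ?_) ?_))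
          (AnalyticAt.mul ?_ ?_) ?_
    · exact AnalyticAt.fun_comp (g := fun w => qShiftedInf w Q) (analyticAt_qShiftedInf hQ _)
        (by fun_prop)
    · exact AnalyticAt.fun_comp (g := fun w => qShiftedInf w Q) (analyticAt_qShiftedInf hQ _)
        (analyticAt_const.div (by fun_prop) (mul_ne_zero hb0 hib))
    · exact analyticAt_comp_const_mul (analyticAt_qTheta hQ (mul_ne_zero ha0 hib))
    · exact analyticAt_qTheta hQ hib
    · exact analyticAt_comp_const_mul (analyticAt_qTheta hQ (mul_ne_zero hab hib))
    · exact mul_ne_zero htib (by rwa [eab])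
  -- The point 1/b lies outside the annulus of `hasDerivAt_qZeta`, so the derivative is carried over
  -- from b by oddness.
  have hzinv : HasDerivAt (qZeta Q) (b * qWeierstrass Q b) (1 / b) := by
    have h1 : HasDerivAt (fun z : ℂ => 1 / z) (-b ^ 2) (1 / b) := by
      refine ((hasDerivAt_const (1 / b) (1 : ℂ)).fun_div (hasDerivAt_id' (1 / b)) hib).congr_deriv ?_
      field_simp
      ring
    have h2 : HasDerivAt (qZeta Q) (qWeierstrass Q b / b) (1 / (1 / b)) := by
      rw [one_div_one_div]
      exact hasDerivAt_qZeta hQ0 hQ hb hb1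
    have h3 : HasDerivAt (fun z => -qZeta Q (1 / z)) _ (1 / b) := (h2.comp (1 / b) h1).neg
    refine (h3.congr_of_eventuallyEq ?_).congr_deriv (by field_simp)
    filter_upwards [isOpen_ne.eventually_mem hib,
      isOpen_ne.eventually_mem (ne_one_of_qTheta_ne_zero hQ htib)] with w h4 h5
    rw [qZeta_inv hQ h4 h5, neg_neg]
  have hzab : HasDerivAt (fun z => qZeta Q (a * b * z)) (b * qWeierstrass Q a) (1 / b) := by
    have h1 : HasDerivAt (fun z : ℂ => a * b * z) (a * b) (1 / b) := by
      simpa using (hasDerivAt_id' (1 / b)).const_mul (a * b)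
    have h2 : HasDerivAt (qZeta Q) (qWeierstrass Q a / a) (a * b * (1 / b)) := by
      rw [eab]
      exact hasDerivAt_qZeta hQ0 hQ ha ha1
    exact (h2.comp (1 / b) h1).congr_deriv (by field_simp)
  have hL := (hzinv.const_add (qZeta Q a + qZeta Q b)).sub hzab
  have hlin : HasDerivAt (fun z : ℂ => 1 - b * z) (-b) (1 / b) := by
    simpa using ((hasDerivAt_id' (1 / b)).const_mul b).const_sub 1
  have hRd := hlin.mul hRa.differentiableAt.hasDerivAt
  have hev : ((fun z => 1 - b * z) * R) =ᶠ[𝓝 (1 / b)]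
      ((fun z => qZeta Q a + qZeta Q b + qZeta Q z) - fun z => qZeta Q (a * b * z)) := by
    have c1 : ∀ᶠ w in 𝓝 (1 / b), qTheta Q w ≠ 0 :=
      (analyticAt_qTheta hQ hib).continuousAt.eventually_ne htib
    have c2 : ∀ᶠ w in 𝓝 (1 / b), qTheta Q (a * b * w) ≠ 0 := by
      have := (analyticAt_comp_const_mul (analyticAt_qTheta hQ (mul_ne_zero hab hib))).continuousAt
      exact this.eventually_ne (by rwa [eab])
    filter_upwards [isOpen_ne.eventually_mem hib, c1, c2] with w h1 h2 h3
    simp only [Pi.mul_apply, Pi.sub_apply, hR]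
    rw [qZeta_add_add_sub hQ0 hQ ha0 hb0 h1 hta htb htab h2 h3, ← hM, qTheta_eq_mul hQ (b * w)]
    ring
  -- Both sides of the four-term formula vanish at z = 1/b, the theta side because of its factor 1 −
  -- bz; their derivatives there are compared.
  have := (hL.congr_of_eventuallyEq hev).unique hRd
  have e1 : R (1 / b) = M * (qShiftedInf Q Q ^ 2 * qTheta Q (a / b)) /
      (-qTheta Q b / b * qTheta Q a) := by
    simp only [hR]
    rw [eab, mul_one_div_cancel hb0, mul_one, div_one, qTheta_inv hQ hb0, mul_one_div]
    ring
  have e2 : qWeierstrass Q a - qWeierstrass Q b = R (1 / b) := by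
    rw [mul_one_div_cancel hb0, sub_self, zero_mul, add_zero] at this
    have h3 : b * (qWeierstrass Q a - qWeierstrass Q b) = b * R (1 / b) := by
      linear_combination -this
    exact mul_left_cancel₀ hb0 h3
  rw [e2, e1, hM]
  field_simp

/-- The addition formula `(ζ(u) + ζ(v) - ζ(u + v))² = ℘(u) + ℘(v) + ℘(u + v)` in `q`-form. -/
theorem qZeta_add_sub_sq (hQ0 : Q ≠ 0) (hQ : ‖Q‖ < 1) {b z : ℂ} (hb : ‖Q‖ < ‖b‖) (hb1 : ‖b‖ < 1)
    (hz : z ≠ 0) (htz : qTheta Q z ≠ 0) (htbz : qTheta Q (b * z) ≠ 0) :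
    (qZeta Q z + qZeta Q b - qZeta Q (b * z)) ^ 2 =
      qWeierstrass Q z + qWeierstrass Q b + qWeierstrass Q (b * z) + 1 / 4 -
        6 * orbitSum geomSeries₁ Q Q := by
  have hb0 : b ≠ 0 := norm_pos_iff.1 ((norm_nonneg Q).trans_lt hb)
  have htb := qTheta_ne_zero_of_norm hQ hb hb1
  set f : ℂ → ℂ := fun z => (qZeta Q z + qZeta Q b - qZeta Q (b * z)) ^ 2 -
    qWeierstrass Q z - qWeierstrass Q (b * z) with hf
  set X : ℂ → ℂ := fun z => qZetaReg Q z + qZeta Q b - qZeta Q (b * z) with hX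
  set Y : ℂ → ℂ := fun z => X z ^ 2 - qWeierstrassReg Q z - qWeierstrass Q (b * z) with hY
  set N : ℂ → ℂ := fun z => 1 + 2 * X z + (1 - z) * Y z with hN
  have hreg : ∀ w ≠ 0, qTheta Q w ≠ 0 → qTheta Q (b * w) ≠ 0 → AnalyticAt ℂ f w := by
    intro w hw h1 h2
    refine AnalyticAt.sub (AnalyticAt.sub (AnalyticAt.pow (AnalyticAt.sub (AnalyticAt.add ?_ ?_) ?_) 2)
      ?_) ?_
    · exact analyticAt_qZeta hQ hw h1
    · exact analyticAt_const
    · exact analyticAt_comp_const_mul (analyticAt_qZeta hQ (mul_ne_zero hb0 hw) h2)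
    · exact analyticAt_qWeierstrass hQ hw h1
    · exact analyticAt_comp_const_mul (analyticAt_qWeierstrass hQ (mul_ne_zero hb0 hw) h2)
  -- The double poles of ζ² and ℘ at 1 cancel, since z/(1−z)² = 1/(1−z)² − 1/(1−z). What remains is
  -- (1 + 2X)/(1−z) plus a regular part, and X(1) = −1/2 removes the simple pole.
  have hX1 : X 1 = -(1 / 2) := by simp [hX, qZetaReg_one]
  have hN1 : N 1 = 0 := by simp only [hN, hX1]; ring
  have hXa : AnalyticAt ℂ X 1 :=
    ((analyticAt_qZetaReg_one hQ).add analyticAt_const).sub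
      (analyticAt_comp_const_mul (analyticAt_qZeta hQ (by simpa) (by simpa)))
  have hYa : AnalyticAt ℂ Y 1 :=
    ((hXa.pow 2).sub (analyticAt_qWeierstrassReg_one hQ)).sub
      (analyticAt_comp_const_mul (analyticAt_qWeierstrass hQ (by simpa) (by simpa)))
  have hNa : AnalyticAt ℂ N 1 :=
    (analyticAt_const.add (analyticAt_const.mul hXa)).add (AnalyticAt.mul (by fun_prop) hYa)
  have hfN : ∀ᶠ w in 𝓝[≠] (1 : ℂ), f w = N w / (1 - w) := by
    filter_upwards [self_mem_nhdsWithin] with w (hw : w ≠ 1)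
    have h3 : 1 - w ≠ 0 := sub_ne_zero.2 hw.symm
    simp only [hf, hN, hY, hX]
    rw [qZeta_eq hQ hw, qWeierstrass_eq hQ w]
    field_simp
    ring
  obtain ⟨k, hk⟩ : ∃ k, ∀ z ≠ 0, Tendsto f (𝓝[≠] z) (𝓝 k) := by
    refine exists_tendsto_of_elliptic_symmetric hQ0 hQ hb0 ?_ ?_ hreg
      (HasRemovableSingularityAt.of_simple_pole hNa hN1 hfN)
    · intro w hw h1 h2
      simp only [hf, mul_left_comm _ Q]
      rw [qZeta_mul hQ0 hQ hw (ne_one_of_qTheta_ne_zero hQ h1),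
        qZeta_mul hQ0 hQ (mul_ne_zero hb0 hw) (ne_one_of_qTheta_ne_zero hQ h2),
        qWeierstrass_mul hQ0 hQ hw, qWeierstrass_mul hQ0 hQ (mul_ne_zero hb0 hw)]
      ring
    · intro w hw h1 h2
      simp only [hf]
      rw [show b * (1 / b / w) = 1 / w by field_simp,
        show 1 / b / w = 1 / (b * w) by field_simp,
        qZeta_inv hQ hw (ne_one_of_qTheta_ne_zero hQ h1),
        qZeta_inv hQ (mul_ne_zero hb0 hw) (ne_one_of_qTheta_ne_zero hQ h2),
        qWeierstrass_inv hQ hw, qWeierstrass_inv hQ (mul_ne_zero hb0 hw)]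
      ring
  have hXd : HasDerivAt X (2 * orbitSum geomSeries₁ Q Q - qWeierstrass Q b) 1 := by
    have h1 : HasDerivAt (fun z : ℂ => b * z) b 1 := by
      simpa using (hasDerivAt_id' (1 : ℂ)).const_mul b
    have h2 : HasDerivAt (qZeta Q) (qWeierstrass Q b / b) (b * 1) := by
      rw [mul_one]
      exact hasDerivAt_qZeta hQ0 hQ hb hb1
    exact (((hasDerivAt_qZetaReg_one hQ0 hQ).add_const _).sub (h2.comp 1 h1)).congr_deriv
      (by field_simp)
  have hNd : HasDerivAt N (2 * (2 * orbitSum geomSeries₁ Q Q - qWeierstrass Q b) - Y 1) 1 := by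
    have hlin : HasDerivAt (fun z : ℂ => 1 - z) (-1) 1 := (hasDerivAt_id' (1 : ℂ)).const_sub 1
    refine (((hXd.const_mul 2).const_add 1).add
      (hlin.mul hYa.differentiableAt.hasDerivAt)).congr_deriv ?_
    ring
  -- The constant is the limit of N(z)/(1 − z) at 1, namely −N′(1).
  have hlim : Tendsto f (𝓝[≠] 1)
      (𝓝 (-(2 * (2 * orbitSum geomSeries₁ Q Q - qWeierstrass Q b) - Y 1))) := by
    refine (hasDerivAt_iff_tendsto_slope.1 hNd).neg.congr' ?_
    filter_upwards [hfN] with w hw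
    rw [hw, slope_def_field, hN1, sub_zero, ← div_neg, neg_sub]
  have hk1 := tendsto_nhds_unique (hk 1 one_ne_zero) hlim
  have hY1 : Y 1 = 1 / 4 - 2 * orbitSum geomSeries₁ Q Q - qWeierstrass Q b := by
    simp only [hY, hX1, qWeierstrassReg_one, mul_one]
    ring
  have hfz : f z = k := tendsto_nhds_unique
    ((hreg z hz htz htbz).continuousAt.tendsto.mono_left nhdsWithin_le_nhds) (hk z hz)
  rw [hk1, hY1] at hfz
  simp only [hf] at hfz
  linear_combination hfz

end

/-! ### Splitting products and sums by residue classes; the half period -/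

theorem hasSum_orbitSum {g : ℂ → ℂ} {Q : ℂ} (hg : DifferentiableOn ℂ g {1}ᶜ) (h0 : g 0 = 0)
    (hQ : ‖Q‖ < 1) (z : ℂ) : HasSum (fun n : ℕ => g (z * Q ^ n)) (orbitSum g Q z) :=
  (summable_orbitSum (hg.mono ball_subset_compl_one) h0 hQ z).hasSum

theorem norm_pow_lt_one {T : ℂ} (hT : ‖T‖ < 1) {m : ℕ} (hm : m ≠ 0) : ‖T ^ m‖ < 1 := by
  rw [norm_pow]
  exact pow_lt_one₀ (norm_nonneg _) hT hm

theorem tendsto_const_mul_atTop_nat {m : ℕ} (hm : m ≠ 0) :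
    Tendsto (fun N : ℕ => m * N) atTop atTop :=
  tendsto_id.const_mul_atTop' (Nat.pos_of_ne_zero hm)

/-- Splitting an infinite shifted factorial according to residue classes. -/
theorem qShiftedInf_eq_prod_residues {T : ℂ} (hT : ‖T‖ < 1) (z : ℂ) {m : ℕ} (hm : m ≠ 0) :
    qShiftedInf z T = ∏ j ∈ Finset.range m, qShiftedInf (z * T ^ j) (T ^ m) := by
  have hfin : ∀ N : ℕ, qShifted z T (m * N) =
      ∏ j ∈ Finset.range m, qShifted (z * T ^ j) (T ^ m) N := by
    intro N
    induction N with
    | zero => simp [qShifted]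
    | succ N ih =>
      rw [qShifted, mul_add, mul_one, Finset.prod_range_add, ← qShifted, ih,
        ← Finset.prod_mul_distrib]
      refine Finset.prod_congr rfl fun j _ => ?_
      rw [qShifted, qShifted, Finset.prod_range_succ]
      ring
  have h1 := (tendsto_qShifted z hT).comp (tendsto_const_mul_atTop_nat hm)
  have h2 := tendsto_finsetProd (Finset.range m) fun j _ =>
    tendsto_qShifted (z * T ^ j) (norm_pow_lt_one hT hm)
  exact tendsto_nhds_unique h1 (h2.congr fun N => (hfin N).symm)

/-- Splitting an orbit sum according to residue classes. -/
theorem orbitSum_eq_sum_residues {g : ℂ → ℂ} (hg : DifferentiableOn ℂ g {1}ᶜ) (h0 : g 0 = 0)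
    {T : ℂ} (hT : ‖T‖ < 1) (z : ℂ) {m : ℕ} (hm : m ≠ 0) :
    orbitSum g T z = ∑ j ∈ Finset.range m, orbitSum g (T ^ m) (z * T ^ j) := by
  have hfin : ∀ N : ℕ, ∑ n ∈ Finset.range (m * N), g (z * T ^ n) =
      ∑ j ∈ Finset.range m, ∑ n ∈ Finset.range N, g (z * T ^ j * (T ^ m) ^ n) := by
    intro N
    induction N with
    | zero => simp
    | succ N ih =>
      rw [mul_add, mul_one, Finset.sum_range_add, ih, ← Finset.sum_add_distrib]
      refine Finset.sum_congr rfl fun j _ => ?_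
      rw [Finset.sum_range_succ]
      ring_nf
  have h1 := (hasSum_orbitSum hg h0 hT z).tendsto_sum_nat.comp (tendsto_const_mul_atTop_nat hm)
  have h2 := tendsto_finsetSum (Finset.range m) fun j _ =>
    (hasSum_orbitSum hg h0 (norm_pow_lt_one hT hm) (z * T ^ j)).tendsto_sum_nat
  exact tendsto_nhds_unique h1 (h2.congr fun N => (hfin N).symm)

theorem qShiftedInf_mul_neg {T : ℂ} (hT : ‖T‖ < 1) (z : ℂ) :
    qShiftedInf z T * qShiftedInf (-z) T = qShiftedInf (z ^ 2) (T ^ 2) := by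
  have h1 := (tendsto_qShifted z hT).mul (tendsto_qShifted (-z) hT)
  refine tendsto_nhds_unique h1
    ((tendsto_qShifted (z ^ 2) (norm_pow_lt_one hT two_ne_zero)).congr fun N => ?_)
  simp only [qShifted, ← Finset.prod_mul_distrib]
  refine Finset.prod_congr rfl fun j _ => ?_
  ring

@[simp] theorem qShiftedInf_zero_left (Q : ℂ) : qShiftedInf 0 Q = 1 := by simp [qShiftedInf]

theorem ramanujanPsi_zero : ramanujanPsi 0 = 1 := by simp [ramanujanPsi]

/-- The half period `1/2`. -/
theorem qZeta_of_sq_eq {Q h : ℂ} (hQ0 : Q ≠ 0) (hh : h ^ 2 = Q) : qZeta Q h = 1 / 2 := by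
  have hh0 : h ≠ 0 := by
    rintro rfl
    exact hQ0 (by rw [← hh]; simp)
  have h1 := qZeta_div hQ0 h
  rw [show Q / h = h by rw [← hh]; field_simp] at h1
  linear_combination h1 / 2

/-! ### Part (a) -/

section
variable {x : ℂ}

theorem norm_pow_lt_norm_pow (hx : ‖x‖ < 1) (hx0 : x ≠ 0) {m n : ℕ} (h : m < n) :
    ‖x ^ n‖ < ‖x ^ m‖ := by
  rw [norm_pow, norm_pow]
  exact pow_lt_pow_right_of_lt_one₀ (norm_pos_iff.2 hx0) hx h

theorem qTheta_pow_ne_zero (hx : ‖x‖ < 1) (hx0 : x ≠ 0) {m n : ℕ} (hm : m ≠ 0) (h : m < n) :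
    qTheta (x ^ n) (x ^ m) ≠ 0 :=
  qTheta_ne_zero_of_norm (norm_pow_lt_one hx (by omega)) (norm_pow_lt_norm_pow hx hx0 h)
    (norm_pow_lt_one hx hm)

theorem div_pow_of_ne_zero (hx0 : x ≠ 0) {m n k : ℕ} (h : n = k + m) : x ^ n / x ^ m = x ^ k := by
  rw [h, pow_add, mul_div_cancel_right₀ _ (pow_ne_zero _ hx0)]

/-- With Q = x⁶ and a = b = z = x, the four-term formula has theta side (Q;Q)²θ(x²)³ / (θ(x)³θ(x³));
splitting the products in ψ modulo 3 produces the same quotient. -/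
theorem ramanujanPsi_cube_div (hx : ‖x‖ < 1) :
    ramanujanPsi x ^ 3 / ramanujanPsi (x ^ 3) =
      1 + 3 * (orbitSum geomSeries₀ (x ^ 6) x - orbitSum geomSeries₀ (x ^ 6) (x ^ 5)) := by
  -- The torus degenerates at x = 0, where both sides equal 1.
  rcases eq_or_ne x 0 with rfl | hx0
  · simp [ramanujanPsi_zero, orbitSum_at_zero]
  have hQ0 : x ^ 6 ≠ 0 := pow_ne_zero _ hx0
  have hQ : ‖x ^ 6‖ < 1 := norm_pow_lt_one hx (by norm_num)
  have hT : ‖x ^ 2‖ < 1 := norm_pow_lt_one hx (by norm_num)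
  have t1 : qTheta (x ^ 6) x ≠ 0 := by
    simpa using qTheta_pow_ne_zero hx hx0 (m := 1) (n := 6) (by norm_num) (by norm_num)
  have t2 : qTheta (x ^ 6) (x * x) ≠ 0 := by
    rw [← sq]
    exact qTheta_pow_ne_zero hx hx0 (by norm_num) (by norm_num)
  have t3 : qTheta (x ^ 6) (x * x * x) ≠ 0 := by
    rw [← pow_three']
    exact qTheta_pow_ne_zero hx hx0 (by norm_num) (by norm_num)
  have key := qZeta_add_add_sub hQ0 hQ hx0 hx0 hx0 t1 t1 t2 t1 t3
  rw [← pow_three', ← sq, qZeta_of_sq_eq hQ0 (by ring : (x ^ 3) ^ 2 = x ^ 6)] at key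
  have e1 : x ^ 6 / x = x ^ 5 := by simpa using div_pow_of_ne_zero hx0 (m := 1) (n := 6) rfl
  have hz : qZeta (x ^ 6) x = 1 / 2 + orbitSum geomSeries₀ (x ^ 6) x -
      orbitSum geomSeries₀ (x ^ 6) (x ^ 5) := by rw [qZeta, e1]
  have p1 : qTheta (x ^ 6) x = qShiftedInf x (x ^ 6) * qShiftedInf (x ^ 5) (x ^ 6) := by
    rw [qTheta, e1]
  have p2 : qTheta (x ^ 6) (x ^ 2) = qShiftedInf (x ^ 2) (x ^ 6) * qShiftedInf (x ^ 4) (x ^ 6) := by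
    rw [qTheta, show x ^ 6 / x ^ 2 = x ^ 4 from div_pow_of_ne_zero hx0 rfl]
  have p3 : qTheta (x ^ 6) (x ^ 3) = qShiftedInf (x ^ 3) (x ^ 6) * qShiftedInf (x ^ 3) (x ^ 6) := by
    rw [qTheta, show x ^ 6 / x ^ 3 = x ^ 3 from div_pow_of_ne_zero hx0 rfl]
  have s1 : qShiftedInf x (x ^ 2) = qShiftedInf x (x ^ 6) * qShiftedInf (x ^ 3) (x ^ 6) *
      qShiftedInf (x ^ 5) (x ^ 6) := by
    rw [qShiftedInf_eq_prod_residues hT x three_ne_zero]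
    simp only [Finset.prod_range_succ, Finset.prod_range_zero]
    ring_nf
  have s2 : qShiftedInf (x ^ 2) (x ^ 2) = qShiftedInf (x ^ 2) (x ^ 6) *
      qShiftedInf (x ^ 4) (x ^ 6) * qShiftedInf (x ^ 6) (x ^ 6) := by
    rw [qShiftedInf_eq_prod_residues hT (x ^ 2) three_ne_zero]
    simp only [Finset.prod_range_succ, Finset.prod_range_zero]
    ring_nf
  have n1 : qShiftedInf x (x ^ 6) ≠ 0 := qShiftedInf_ne_zero hx hQ
  have n : ∀ m : ℕ, m ≠ 0 → qShiftedInf (x ^ m) (x ^ 6) ≠ 0 := fun m hm =>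
    qShiftedInf_ne_zero (norm_pow_lt_one hx hm) hQ
  have n2 := n 2 (by norm_num)
  have n3 := n 3 (by norm_num)
  have n4 := n 4 (by norm_num)
  have n5 := n 5 (by norm_num)
  have n6 := n 6 (by norm_num)
  have e : (1 : ℂ) + 3 * (orbitSum geomSeries₀ (x ^ 6) x - orbitSum geomSeries₀ (x ^ 6) (x ^ 5)) =
      qZeta (x ^ 6) x + qZeta (x ^ 6) x + qZeta (x ^ 6) x - 1 / 2 := by
    rw [hz]
    ring
  rw [e, key, p1, p2, p3, ramanujanPsi, ramanujanPsi, show (x ^ 3) ^ 2 = x ^ 6 by ring, s1, s2]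
  field_simp

/-- The addition formula at (x, x²), (x, x) and (x², x²) involves only ζ(x) and ζ(x²), because ζ(x³)
= 1/2 and ζ(x⁴) = 1 − ζ(x²). -/
theorem sq_one_add_lambert_eq (hx : ‖x‖ < 1) :
    (1 + 3 * (orbitSum geomSeries₀ (x ^ 6) x - orbitSum geomSeries₀ (x ^ 6) (x ^ 5))) ^ 2 =
      1 + 3 * (orbitSum geomSeries₁ (x ^ 2) (x ^ 2) + 2 * orbitSum geomSeries₁ (x ^ 2) x -
        9 * orbitSum geomSeries₁ (x ^ 6) (x ^ 6)) := by
  rcases eq_or_ne x 0 with rfl | hx0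
  · simp [orbitSum_at_zero]
  have hQ0 : x ^ 6 ≠ 0 := pow_ne_zero _ hx0
  have hQ : ‖x ^ 6‖ < 1 := norm_pow_lt_one hx (by norm_num)
  have hT : ‖x ^ 2‖ < 1 := norm_pow_lt_one hx (by norm_num)
  have e1 : x ^ 6 / x = x ^ 5 := by simpa using div_pow_of_ne_zero hx0 (m := 1) (n := 6) rfl
  have e2 : x ^ 6 / x ^ 2 = x ^ 4 := div_pow_of_ne_zero hx0 rfl
  have e3 : x ^ 6 / x ^ 3 = x ^ 3 := div_pow_of_ne_zero hx0 rfl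
  have b1 : ‖x ^ 6‖ < ‖x‖ := by
    simpa only [pow_one] using norm_pow_lt_norm_pow hx hx0 (m := 1) (n := 6) (by norm_num)
  have t : ∀ m : ℕ, m ≠ 0 → m < 6 → qTheta (x ^ 6) (x ^ m) ≠ 0 := fun m hm h =>
    qTheta_pow_ne_zero hx hx0 hm h
  have t1 : qTheta (x ^ 6) x ≠ 0 := by simpa using t 1 (by norm_num) (by norm_num)
  have T1 := qZeta_add_sub_sq hQ0 hQ b1 hx (pow_ne_zero 2 hx0) (t 2 (by norm_num) (by norm_num))
    (by rw [← pow_succ']; exact t 3 (by norm_num) (by norm_num))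
  have T2 := qZeta_add_sub_sq hQ0 hQ b1 hx hx0 t1
    (by rw [← sq]; exact t 2 (by norm_num) (by norm_num))
  have T3 := qZeta_add_sub_sq hQ0 hQ (norm_pow_lt_norm_pow hx hx0 (m := 2) (n := 6) (by norm_num)) hT
    (pow_ne_zero 2 hx0) (t 2 (by norm_num) (by norm_num))
    (by rw [← pow_add]; exact t 4 (by norm_num) (by norm_num))
  have z4 : qZeta (x ^ 6) (x ^ 4) = 1 - qZeta (x ^ 6) (x ^ 2) := by rw [← e2, qZeta_div hQ0]
  have w4 : qWeierstrass (x ^ 6) (x ^ 4) = qWeierstrass (x ^ 6) (x ^ 2) := by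
    rw [← e2, qWeierstrass_div hQ0]
  rw [← pow_succ', qZeta_of_sq_eq hQ0 (by ring : (x ^ (2 + 1)) ^ 2 = x ^ 6)] at T1
  rw [← sq] at T2
  rw [← pow_add, z4, w4] at T3
  have hz : qZeta (x ^ 6) x = 1 / 2 + orbitSum geomSeries₀ (x ^ 6) x -
      orbitSum geomSeries₀ (x ^ 6) (x ^ 5) := by rw [qZeta, e1]
  have w1 : qWeierstrass (x ^ 6) x = orbitSum geomSeries₁ (x ^ 6) x +
      orbitSum geomSeries₁ (x ^ 6) (x ^ 5) := by rw [qWeierstrass, e1]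
  have w2 : qWeierstrass (x ^ 6) (x ^ 2) = orbitSum geomSeries₁ (x ^ 6) (x ^ 2) +
      orbitSum geomSeries₁ (x ^ 6) (x ^ 4) := by rw [qWeierstrass, e2]
  have w3 : qWeierstrass (x ^ 6) (x ^ (2 + 1)) = orbitSum geomSeries₁ (x ^ 6) (x ^ 3) +
      orbitSum geomSeries₁ (x ^ 6) (x ^ 3) := by rw [qWeierstrass, e3]
  have s1 : orbitSum geomSeries₁ (x ^ 2) x = orbitSum geomSeries₁ (x ^ 6) x +
      orbitSum geomSeries₁ (x ^ 6) (x ^ 3) + orbitSum geomSeries₁ (x ^ 6) (x ^ 5) := by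
    rw [orbitSum_eq_sum_residues differentiableOn_geomSeries₁ geomSeries₁_zero hT x three_ne_zero]
    simp only [Finset.sum_range_succ, Finset.sum_range_zero]
    ring_nf
  have s2 : orbitSum geomSeries₁ (x ^ 2) (x ^ 2) = orbitSum geomSeries₁ (x ^ 6) (x ^ 2) +
      orbitSum geomSeries₁ (x ^ 6) (x ^ 4) + orbitSum geomSeries₁ (x ^ 6) (x ^ 6) := by
    rw [orbitSum_eq_sum_residues differentiableOn_geomSeries₁ geomSeries₁_zero hT _ three_ne_zero]
    simp only [Finset.sum_range_succ, Finset.sum_range_zero]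
    ring_nf
  have e : (1 : ℂ) + 3 * (orbitSum geomSeries₀ (x ^ 6) x - orbitSum geomSeries₀ (x ^ 6) (x ^ 5)) =
      3 * qZeta (x ^ 6) x - 1 / 2 := by
    rw [hz]
    ring
  rw [e, s1, s2]
  rw [w1, w2, w3] at T1
  rw [w1, w2] at T2
  rw [w2] at T3
  -- These weights cancel every term in ζ(x²) and leave (3ζ(x) − 1/2)² on the squared side.
  linear_combination 3 * T1 + 3 / 2 * T2 - 1 / 2 * T3

end

/-! ### Part (b): evaluations of ℘ by theta products -/

section
variable {q : ℂ}

theorem qTheta_sq_of_sq {Q h : ℂ} (hh0 : h ≠ 0) (hh : h ^ 2 = Q) :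
    qTheta Q h = qShiftedInf h Q ^ 2 := by
  rw [qTheta, show Q / h = h by rw [← hh]; field_simp, sq]

/-- Euler's identity `(-y; y)_∞ (y; y²)_∞ = 1`. -/
theorem qShiftedInf_neg_mul_qShiftedInf_sq {y : ℂ} (hy : ‖y‖ < 1) :
    qShiftedInf (-y) y * qShiftedInf y (y ^ 2) = 1 := by
  have h2 : ‖y ^ 2‖ < 1 := norm_pow_lt_one hy two_ne_zero
  have h3 := qShiftedInf_mul_neg hy y
  have h4 := qShiftedInf_eq_prod_residues hy y two_ne_zero
  simp only [Finset.prod_range_succ, Finset.prod_range_zero, pow_zero, pow_one, mul_one,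
    one_mul, ← sq] at h4
  have h5 : qShiftedInf (y ^ 2) (y ^ 2) ≠ 0 := qShiftedInf_ne_zero h2 h2
  refine mul_left_cancel₀ h5 ?_
  rw [h4] at h3
  linear_combination h3

/-- In the product formula at a = q, b = −q, the factor theta(−1) supplies the 2, and Euler's
identity with y = q² replaces (−q²; q²)_∞ by 1/(q²; q⁴)_∞. -/
theorem qWeierstrass_sub_neg (hq : ‖q‖ < 1) (hq0 : q ≠ 0) :
    qWeierstrass (q ^ 4) q - qWeierstrass (q ^ 4) (-q) = 2 * (q * ramanujanPsi (q ^ 2) ^ 4) := by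
  have hQ0 : q ^ 4 ≠ 0 := pow_ne_zero _ hq0
  have hQ : ‖q ^ 4‖ < 1 := norm_pow_lt_one hq (by norm_num)
  have h2 : ‖q ^ 2‖ < 1 := norm_pow_lt_one hq (by norm_num)
  have b1 : ‖q ^ 4‖ < ‖q‖ := by
    simpa only [pow_one] using norm_pow_lt_norm_pow hq hq0 (m := 1) (n := 4) (by norm_num)
  have b2 : ‖q ^ 4‖ < ‖q ^ 2‖ := norm_pow_lt_norm_pow hq hq0 (by norm_num)
  have ht : qTheta (q ^ 4) (q * -q) ≠ 0 := by
    rw [show q * -q = -q ^ 2 by ring]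
    exact qTheta_ne_zero_of_norm hQ (by rwa [norm_neg]) (by rwa [norm_neg])
  rw [qWeierstrass_sub hQ0 hQ b1 hq (by rwa [norm_neg]) (by rwa [norm_neg]) ht]
  have em : q / -q = -1 := by rw [div_neg, div_self hq0]
  have e1 : q ^ 4 / q = q ^ 3 := by simpa using div_pow_of_ne_zero hq0 (m := 1) (n := 4) rfl
  have p1 : qTheta (q ^ 4) (-1) = 2 * qShiftedInf (-q ^ 4) (q ^ 4) ^ 2 := by
    rw [qTheta_eq_mul hQ, div_neg, div_one, mul_neg, mul_one]
    ring
  have p2 : qTheta (q ^ 4) (q * -q) = qShiftedInf (-q ^ 2) (q ^ 4) ^ 2 := by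
    rw [show q * -q = -q ^ 2 by ring, qTheta_sq_of_sq (by simpa) (by ring)]
  have p3 : qTheta (q ^ 4) q * qTheta (q ^ 4) (-q) = qShiftedInf (q ^ 2) (q ^ 4) := by
    have h3 := qShiftedInf_mul_neg h2 q
    rw [qShiftedInf_eq_prod_residues h2 q two_ne_zero,
      qShiftedInf_eq_prod_residues h2 (-q) two_ne_zero, ← pow_mul] at h3
    simp only [Finset.prod_range_succ, Finset.prod_range_zero, one_mul] at h3
    rw [← h3, qTheta, qTheta, div_neg, e1]
    ring_nf
  have p4 : qShiftedInf (-q ^ 2) (q ^ 4) * qShiftedInf (-q ^ 4) (q ^ 4) *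
      qShiftedInf (q ^ 2) (q ^ 4) = 1 := by
    have h3 := qShiftedInf_neg_mul_qShiftedInf_sq h2
    rw [qShiftedInf_eq_prod_residues h2 (-q ^ 2) two_ne_zero] at h3
    simp only [Finset.prod_range_succ, Finset.prod_range_zero, one_mul, ← pow_mul] at h3
    rw [← h3]
    ring_nf
  have hpsi : ramanujanPsi (q ^ 2) = qShiftedInf (q ^ 4) (q ^ 4) / qShiftedInf (q ^ 2) (q ^ 4) := by
    rw [ramanujanPsi, ← pow_mul]
  have n2 : qShiftedInf (q ^ 2) (q ^ 4) ≠ 0 := qShiftedInf_ne_zero h2 hQ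
  rw [em, p1, p2, ← mul_pow, p3, hpsi]
  field_simp
  linear_combination qShiftedInf (q ^ 4) (q ^ 4) ^ 4 *
    (qShiftedInf (-q ^ 2) (q ^ 4) * qShiftedInf (-q ^ 4) (q ^ 4) *
      qShiftedInf (q ^ 2) (q ^ 4) + 1) * p4

/-- With a double zero displayed, the second derivative is read off without differentiating the
cofactor `H`, here a quotient of theta products. -/
theorem deriv_deriv_of_eq_add_sq_mul {f H : ℂ → ℂ} {b c : ℂ} (hH : AnalyticAt ℂ H b)
    (hf : ∀ᶠ w in 𝓝 b, f w = c + (w - b) ^ 2 * H w) : HasDerivAt (deriv f) (2 * H b) b := by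
  have hd : deriv f =ᶠ[𝓝 b] fun w => (w - b) * (2 * H w + (w - b) * deriv H w) := by
    filter_upwards [hf.eventually_nhds, hH.eventually_analyticAt] with w h1 h2
    have h3 : HasDerivAt (fun w => (w - b) ^ 2) (2 * (w - b)) w := by
      simpa using ((hasDerivAt_id' w).sub_const b).fun_pow 2
    have h4 : HasDerivAt (fun w => c + (w - b) ^ 2 * H w) _ w :=
      (h3.mul h2.differentiableAt.hasDerivAt).const_add c
    rw [(h4.congr_of_eventuallyEq h1).deriv]
    ring
  have h5 : HasDerivAt (fun w => w - b) 1 b := (hasDerivAt_id' b).sub_const b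
  have h6 : DifferentiableAt ℂ (fun w => 2 * H w + (w - b) * deriv H w) b := by
    have := hH.differentiableAt
    have := hH.deriv.differentiableAt
    fun_prop
  have h7 := (h5.mul h6.hasDerivAt).congr_of_eventuallyEq hd
  refine h7.congr_deriv ?_
  simp

/-- The second derivative of ℘ at the half period q² is computed twice: termwise, where the two
half-orbits coincide, and from the double zero of the product formula as a → q². -/
theorem orbitSum_geomSeries₃_eq (hq : ‖q‖ < 1) :
    orbitSum geomSeries₃ (q ^ 4) (q ^ 2) = (q * ramanujanPsi (q ^ 2) ^ 4) ^ 2 := by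
  rcases eq_or_ne q 0 with rfl | hq0
  · simp [orbitSum_at_zero]
  have hQ0 : q ^ 4 ≠ 0 := pow_ne_zero _ hq0
  have hQ : ‖q ^ 4‖ < 1 := norm_pow_lt_one hq (by norm_num)
  have h2 : ‖q ^ 2‖ < 1 := norm_pow_lt_one hq (by norm_num)
  have b2 : ‖q ^ 4‖ < ‖q ^ 2‖ := norm_pow_lt_norm_pow hq hq0 (by norm_num)
  have hb0 : q ^ 2 ≠ 0 := pow_ne_zero _ hq0
  have htb : qTheta (q ^ 4) (q ^ 2) ≠ 0 := qTheta_ne_zero_of_norm hQ b2 h2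
  have hann : ∀ᶠ w in 𝓝 (q ^ 2), ‖q ^ 4‖ < ‖w‖ ∧ ‖w‖ < 1 :=
    (continuous_norm.continuousAt.eventually_const_lt b2).and
      (continuous_norm.continuousAt.eventually_lt_const h2)
  set H : ℂ → ℂ := fun a => qShiftedInf (q ^ 4) (q ^ 4) ^ 4 *
    (qShiftedInf (q ^ 4 * (a / q ^ 2)) (q ^ 4) * qShiftedInf (q ^ 4 / (a / q ^ 2)) (q ^ 4)) ^ 2 /
      (a * (qTheta (q ^ 4) a ^ 2 * qTheta (q ^ 4) (q ^ 2) ^ 2)) with hH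
  have hHa : AnalyticAt ℂ H (q ^ 2) := by
    refine AnalyticAt.div (analyticAt_const.mul (AnalyticAt.pow (AnalyticAt.mul ?_ ?_) 2))
      (analyticAt_id.mul (((analyticAt_qTheta hQ hb0).pow 2).mul analyticAt_const)) ?_
    · exact AnalyticAt.fun_comp (g := fun w => qShiftedInf w (q ^ 4))
        (f := fun a => q ^ 4 * (a / q ^ 2)) (analyticAt_qShiftedInf hQ _)
        (analyticAt_const.mul (analyticAt_id.div analyticAt_const hb0))
    · exact AnalyticAt.fun_comp (g := fun w => qShiftedInf w (q ^ 4))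
        (f := fun a => q ^ 4 / (a / q ^ 2)) (analyticAt_qShiftedInf hQ _)
        (analyticAt_const.div (analyticAt_id.div analyticAt_const hb0) (by simp [hq0]))
    · exact mul_ne_zero hb0 (mul_ne_zero (pow_ne_zero 2 htb) (pow_ne_zero 2 htb))
  have hP : ∀ᶠ a in 𝓝 (q ^ 2), qWeierstrass (q ^ 4) a =
      qWeierstrass (q ^ 4) (q ^ 2) + (a - q ^ 2) ^ 2 * H a := by
    have hp : ∀ᶠ a in 𝓝[≠] (q ^ 2), qWeierstrass (q ^ 4) a =
        qWeierstrass (q ^ 4) (q ^ 2) + (a - q ^ 2) ^ 2 * H a := by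
      filter_upwards [hann.filter_mono nhdsWithin_le_nhds,
        eventually_qTheta_const_mul_ne_zero hQ0 hQ hb0 hb0] with a ha hta
      rw [mul_comm] at hta
      have ha0 : a ≠ 0 := norm_pos_iff.1 ((norm_nonneg _).trans_lt ha.1)
      have h3 := qWeierstrass_sub hQ0 hQ ha.1 ha.2 b2 h2 hta
      have h4 : qTheta (q ^ 4) a ≠ 0 := qTheta_ne_zero_of_norm hQ ha.1 ha.2
      -- As q² is a half period, aq² = Q·(a/q²), so both theta factors in the numerator vanish at a
      -- = q².
      have h5 : qTheta (q ^ 4) (a * q ^ 2) = -qTheta (q ^ 4) (a / q ^ 2) / (a / q ^ 2) := by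
        rw [← qTheta_mul hQ0 hQ (div_ne_zero ha0 hb0)]
        congr 1
        field_simp
      rw [h5, qTheta_eq_mul hQ (a / q ^ 2)] at h3
      rw [sub_eq_iff_eq_add'.1 h3, hH]
      field_simp
      ring
    rw [eventually_nhdsWithin_iff] at hp
    filter_upwards [hp] with a ha
    rcases eq_or_ne a (q ^ 2) with rfl | hne
    · simp
    · exact ha hne
  have hD := deriv_deriv_of_eq_add_sq_mul hHa hP
  have hqq : q ^ 4 / q ^ 2 = q ^ 2 := div_pow_of_ne_zero hq0 rfl
  have hA : HasDerivAt (fun z => orbitSum geomSeries₂ (q ^ 4) z -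
      orbitSum geomSeries₂ (q ^ 4) (q ^ 4 / z))
      (2 * orbitSum geomSeries₃ (q ^ 4) (q ^ 2) / q ^ 2) (q ^ 2) := by
    have ha := hasDerivAt_orbitSum_of_euler
      (differentiableOn_geomSeries₂.mono ball_subset_compl_one)
      geomSeries₂_zero hQ (fun _ => mul_deriv_geomSeries₂) h2 hb0
    have hb := hasDerivAt_orbitSum_div differentiableOn_geomSeries₂ geomSeries₂_zero hQ hQ0
      mul_deriv_geomSeries₂ b2
    refine (ha.sub hb).congr_deriv ?_
    rw [hqq]
    ring
  have hD2 : HasDerivAt (deriv (qWeierstrass (q ^ 4)))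
      (2 * orbitSum geomSeries₃ (q ^ 4) (q ^ 2) / q ^ 4) (q ^ 2) := by
    refine ((hA.fun_div (hasDerivAt_id' (q ^ 2)) hb0).congr_of_eventuallyEq ?_).congr_deriv ?_
    · filter_upwards [hann] with w hw
      exact (hasDerivAt_qWeierstrass hQ0 hQ hw.1 hw.2).deriv
    -- The quotient rule's extra term carries ℘′(q²) = 0, its two half-orbit sums being equal.
    · rw [hqq]
      field_simp
      ring
  have huniq := hD2.unique hD
  have hHb : H (q ^ 2) = qShiftedInf (q ^ 4) (q ^ 4) ^ 8 /
      (q ^ 2 * qShiftedInf (q ^ 2) (q ^ 4) ^ 8) := by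
    simp only [hH]
    rw [div_self hb0, mul_one, div_one, qTheta_sq_of_sq hb0 (by ring)]
    ring_nf
  have n2 : qShiftedInf (q ^ 2) (q ^ 4) ≠ 0 := qShiftedInf_ne_zero h2 hQ
  rw [hHb] at huniq
  rw [ramanujanPsi, ← pow_mul]
  norm_num
  field_simp at huniq ⊢
  linear_combination huniq

end

/-! ### Part (b): the Lambert double series -/

/-- The double series `∑ m q ^ (m k)` over odd `m` and `k`. -/
theorem summable_odd_lambert {q : ℂ} (hq : ‖q‖ < 1) :
    Summable fun p : ℕ × ℕ => (2 * (p.1 : ℂ) + 1) * q ^ ((2 * p.1 + 1) * (2 * p.2 + 1)) := by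
  have h0 : Summable fun n : ℕ => ‖q‖ ^ n := summable_geometric_of_lt_one (norm_nonneg q) hq
  have h1 : Summable fun n : ℕ => (2 * (n : ℝ) + 1) * ‖q‖ ^ n := by
    have := summable_pow_mul_geometric_of_norm_lt_one 1 (r := ‖q‖) (by rwa [norm_norm])
    refine ((this.mul_left 2).add h0).congr fun n => ?_
    ring
  have h2 := h1.mul_of_nonneg h0 (fun n => by positivity) (fun n => by positivity)
  refine Summable.of_norm_bounded h2 fun p => ?_
  have e : ‖(2 * (p.1 : ℂ) + 1)‖ = 2 * (p.1 : ℝ) + 1 := by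
    have : (2 * (p.1 : ℂ) + 1) = ((2 * p.1 + 1 : ℕ) : ℂ) := by push_cast; ring
    rw [this, Complex.norm_natCast]
    push_cast
    ring
  rw [norm_mul, e, norm_pow, mul_assoc, ← pow_add]
  gcongr ?_ * ?_
  -- The exponent (2m+1)(2k+1) is at least m + k, which dominates the double series by a product of
  -- two convergent series.
  exact pow_le_pow_of_le_one (norm_nonneg q) hq.le (by nlinarith)

theorem HasSum.congr_of_eq {f g : ℕ → ℂ} {a b : ℂ} (h : HasSum f a) (hfg : ∀ n, g n = f n)
    (hab : b = a) : HasSum g b := by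
  rw [funext hfg, hab]
  exact h

/-- The odd part of y/(1 − y)² = ∑ k y^k. -/
theorem hasSum_odd_mul_pow {y : ℂ} (hy : ‖y‖ < 1) :
    HasSum (fun n : ℕ => (2 * (n : ℂ) + 1) * y ^ (2 * n + 1))
      ((geomSeries₁ y - geomSeries₁ (-y)) / 2) := by
  have h2 : ‖y ^ 2‖ < 1 := norm_pow_lt_one hy two_ne_zero
  have h := ((hasSum_coe_mul_geometric_of_norm_lt_one h2).mul_left 2).add
    (hasSum_geometric_of_norm_lt_one h2)
  have h1 : 1 - y ≠ 0 := sub_ne_zero.2 (by rintro rfl; simp at hy)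
  have h3 : 1 + y ≠ 0 := by
    intro h
    rw [eq_neg_of_add_eq_zero_right h] at hy
    simp at hy
  have h4 : 1 - y ^ 2 ≠ 0 := by
    rw [show 1 - y ^ 2 = (1 - y) * (1 + y) by ring]
    exact mul_ne_zero h1 h3
  refine (h.mul_left y).congr_of_eq (fun n => ?_) ?_
  · ring
  · unfold geomSeries₁
    rw [sub_neg_eq_add, show 1 - y ^ 2 = (1 - y) * (1 + y) by ring]
    field_simp
    ring

/-- One double series is summed in two orders: rows are geometric and give the Lambert terms,
columns are odd parts whose total is (℘(q) − ℘(−q))/2. -/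
theorem hasSum_lambert_odd {q : ℂ} (hq : ‖q‖ < 1) :
    HasSum (fun n : ℕ => (2 * (n : ℂ) + 1) * q ^ (2 * n + 1) / (1 - q ^ (4 * n + 2)))
      (q * ramanujanPsi (q ^ 2) ^ 4) := by
  rcases eq_or_ne q 0 with rfl | hq0
  · simp [hasSum_zero]
  have hs := summable_odd_lambert hq
  have h2 : ‖q ^ 2‖ < 1 := norm_pow_lt_one hq two_ne_zero
  have hrow : ∀ n : ℕ, HasSum
      (fun k : ℕ => (2 * (n : ℂ) + 1) * q ^ ((2 * n + 1) * (2 * k + 1)))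
      ((2 * (n : ℂ) + 1) * q ^ (2 * n + 1) / (1 - q ^ (4 * n + 2))) := by
    intro n
    have h := (hasSum_geometric_of_norm_lt_one
      (norm_pow_lt_one hq (by omega : 4 * n + 2 ≠ 0))).mul_left ((2 * (n : ℂ) + 1) * q ^ (2 * n + 1))
    exact h.congr_of_eq (fun k => by ring) (div_eq_mul_inv _ _)
  have hcol : ∀ k : ℕ, HasSum
      (fun n : ℕ => (2 * (n : ℂ) + 1) * q ^ ((2 * n + 1) * (2 * k + 1)))
      ((geomSeries₁ (q * (q ^ 2) ^ k) - geomSeries₁ (-q * (q ^ 2) ^ k)) / 2) := by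
    intro k
    have e : q * (q ^ 2) ^ k = q ^ (2 * k + 1) := by ring
    have h := hasSum_odd_mul_pow (norm_pow_lt_one hq (by omega : 2 * k + 1 ≠ 0))
    rw [neg_mul, e]
    exact h.congr_of_eq (fun n => by ring) rfl
  have hsum : HasSum
      (fun k : ℕ => (geomSeries₁ (q * (q ^ 2) ^ k) - geomSeries₁ (-q * (q ^ 2) ^ k)) / 2)
      (q * ramanujanPsi (q ^ 2) ^ 4) := by
    have h := ((hasSum_orbitSum differentiableOn_geomSeries₁ geomSeries₁_zero h2 q).sub
      (hasSum_orbitSum differentiableOn_geomSeries₁ geomSeries₁_zero h2 (-q))).div_const 2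
    refine h.congr_of_eq (fun _ => rfl) ?_
    have hw := qWeierstrass_sub_neg hq hq0
    have e1 : q ^ 4 / q = q * q ^ 2 := by field_simp
    rw [qWeierstrass, qWeierstrass, div_neg, e1] at hw
    -- Modulo Q = q⁴ the q²-orbit of q splits into the orbits of q and q³ = Q/q, which are the two
    -- halves of ℘(q); likewise for −q.
    rw [orbitSum_eq_sum_residues differentiableOn_geomSeries₁ geomSeries₁_zero h2 q two_ne_zero,
      orbitSum_eq_sum_residues differentiableOn_geomSeries₁ geomSeries₁_zero h2 (-q) two_ne_zero]
    simp only [Finset.sum_range_succ, Finset.sum_range_zero, zero_add, pow_zero, mul_one, pow_one,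
      neg_mul, show (q ^ 2) ^ 2 = q ^ 4 by ring]
    linear_combination -hw / 2
  have ht := hs.hasSum.prod_fiberwise hrow
  have hs' := hs.hasSum
  rw [← (Equiv.prodComm ℕ ℕ).hasSum_iff] at hs'
  have hc := hs'.prod_fiberwise hcol
  rwa [hc.unique hsum] at ht

/-! ### Translation to the stated series -/

theorem hasSum_pnat_of_succ {F : ℕ → ℂ} {s : ℂ} (h : HasSum (fun n => F (n + 1)) s) :
    HasSum (fun n : ℕ+ => F n) s := by
  rw [← Equiv.pnatEquivNat.symm.hasSum_iff]
  exact h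

theorem theorem1p4 (q : ℂ) (hq : ‖q‖ < 1) :
    -- part (a): the two series converge, and the three expressions agree
    ((Summable fun n : ℕ+ =>
        q ^ (18 * (n : ℕ) - 15) / (1 - q ^ (18 * (n : ℕ) - 15))
          - q ^ (18 * (n : ℕ) - 3) / (1 - q ^ (18 * (n : ℕ) - 3))) ∧
      (Summable fun n : ℕ+ =>
        q ^ (6 * (n : ℕ)) / (1 - q ^ (6 * (n : ℕ))) ^ 2
          + 2 * q ^ (6 * (n : ℕ) - 3) / (1 - q ^ (6 * (n : ℕ) - 3)) ^ 2
          - 9 * q ^ (18 * (n : ℕ)) / (1 - q ^ (18 * (n : ℕ))) ^ 2) ∧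
      (ramanujanPsi (q ^ 3) ^ 3 / ramanujanPsi (q ^ 9)) ^ 2
        = (1 + 3 * ∑' n : ℕ+,
            (q ^ (18 * (n : ℕ) - 15) / (1 - q ^ (18 * (n : ℕ) - 15))
              - q ^ (18 * (n : ℕ) - 3) / (1 - q ^ (18 * (n : ℕ) - 3)))) ^ 2 ∧
      (ramanujanPsi (q ^ 3) ^ 3 / ramanujanPsi (q ^ 9)) ^ 2
        = 1 + 3 * ∑' n : ℕ+,
            (q ^ (6 * (n : ℕ)) / (1 - q ^ (6 * (n : ℕ))) ^ 2
              + 2 * q ^ (6 * (n : ℕ) - 3) / (1 - q ^ (6 * (n : ℕ) - 3)) ^ 2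
              - 9 * q ^ (18 * (n : ℕ)) / (1 - q ^ (18 * (n : ℕ))) ^ 2)) ∧
    -- part (b): the two series converge, and the three expressions agree
    ((Summable fun n : ℕ+ =>
        (2 * (n : ℂ) - 1) * q ^ (2 * (n : ℕ) - 1) / (1 - q ^ (4 * (n : ℕ) - 2))) ∧
      (Summable fun n : ℕ+ =>
        6 * q ^ (8 * (n : ℕ) - 4) / (1 - q ^ (4 * (n : ℕ) - 2)) ^ 4
          + q ^ (4 * (n : ℕ) - 2) / (1 - q ^ (4 * (n : ℕ) - 2)) ^ 2) ∧
      (q * ramanujanPsi (q ^ 2) ^ 4) ^ 2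
        = (∑' n : ℕ+,
            (2 * (n : ℂ) - 1) * q ^ (2 * (n : ℕ) - 1) / (1 - q ^ (4 * (n : ℕ) - 2))) ^ 2 ∧
      (q * ramanujanPsi (q ^ 2) ^ 4) ^ 2
        = ∑' n : ℕ+,
            (6 * q ^ (8 * (n : ℕ) - 4) / (1 - q ^ (4 * (n : ℕ) - 2)) ^ 4
              + q ^ (4 * (n : ℕ) - 2) / (1 - q ^ (4 * (n : ℕ) - 2)) ^ 2)) := by
  have hx : ‖q ^ 3‖ < 1 := norm_pow_lt_one hq three_ne_zero
  have hx2 : ‖(q ^ 3) ^ 2‖ < 1 := norm_pow_lt_one hx (by norm_num)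
  have hx6 : ‖(q ^ 3) ^ 6‖ < 1 := norm_pow_lt_one hx (by norm_num)
  have ha1 : HasSum (fun n : ℕ+ =>
      q ^ (18 * (n : ℕ) - 15) / (1 - q ^ (18 * (n : ℕ) - 15))
        - q ^ (18 * (n : ℕ) - 3) / (1 - q ^ (18 * (n : ℕ) - 3)))
      (orbitSum geomSeries₀ ((q ^ 3) ^ 6) (q ^ 3) -
        orbitSum geomSeries₀ ((q ^ 3) ^ 6) ((q ^ 3) ^ 5)) := by
    refine hasSum_pnat_of_succ (F := fun n : ℕ => q ^ (18 * n - 15) / (1 - q ^ (18 * n - 15))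
        - q ^ (18 * n - 3) / (1 - q ^ (18 * n - 3))) ?_
    refine ((hasSum_orbitSum differentiableOn_geomSeries₀ geomSeries₀_zero hx6 (q ^ 3)).sub
      (hasSum_orbitSum differentiableOn_geomSeries₀ geomSeries₀_zero hx6
        ((q ^ 3) ^ 5))).congr_of_eq (fun n => ?_) rfl
    rw [show 18 * (n + 1) - 15 = 18 * n + 3 by omega, show 18 * (n + 1) - 3 = 18 * n + 15 by omega,
      show q ^ 3 * ((q ^ 3) ^ 6) ^ n = q ^ (18 * n + 3) by ring,
      show (q ^ 3) ^ 5 * ((q ^ 3) ^ 6) ^ n = q ^ (18 * n + 15) by ring, geomSeries₀, geomSeries₀]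
  have ha2 : HasSum (fun n : ℕ+ =>
      q ^ (6 * (n : ℕ)) / (1 - q ^ (6 * (n : ℕ))) ^ 2
        + 2 * q ^ (6 * (n : ℕ) - 3) / (1 - q ^ (6 * (n : ℕ) - 3)) ^ 2
        - 9 * q ^ (18 * (n : ℕ)) / (1 - q ^ (18 * (n : ℕ))) ^ 2)
      (orbitSum geomSeries₁ ((q ^ 3) ^ 2) ((q ^ 3) ^ 2) +
        2 * orbitSum geomSeries₁ ((q ^ 3) ^ 2) (q ^ 3) -
        9 * orbitSum geomSeries₁ ((q ^ 3) ^ 6) ((q ^ 3) ^ 6)) := by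
    refine hasSum_pnat_of_succ (F := fun n : ℕ => q ^ (6 * n) / (1 - q ^ (6 * n)) ^ 2
        + 2 * q ^ (6 * n - 3) / (1 - q ^ (6 * n - 3)) ^ 2
        - 9 * q ^ (18 * n) / (1 - q ^ (18 * n)) ^ 2) ?_
    refine (((hasSum_orbitSum differentiableOn_geomSeries₁ geomSeries₁_zero hx2 ((q ^ 3) ^ 2)).add
      ((hasSum_orbitSum differentiableOn_geomSeries₁ geomSeries₁_zero hx2 (q ^ 3)).mul_left 2)).sub
      ((hasSum_orbitSum differentiableOn_geomSeries₁ geomSeries₁_zero hx6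
        ((q ^ 3) ^ 6)).mul_left 9)).congr_of_eq (fun n => ?_) rfl
    rw [show 6 * (n + 1) - 3 = 6 * n + 3 by omega,
      show (q ^ 3) ^ 2 * ((q ^ 3) ^ 2) ^ n = q ^ (6 * (n + 1)) by ring,
      show q ^ 3 * ((q ^ 3) ^ 2) ^ n = q ^ (6 * n + 3) by ring,
      show (q ^ 3) ^ 6 * ((q ^ 3) ^ 6) ^ n = q ^ (18 * (n + 1)) by ring,
      geomSeries₁, geomSeries₁, geomSeries₁, mul_div_assoc, mul_div_assoc]
  have hb1 : HasSum (fun n : ℕ+ =>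
      (2 * (n : ℂ) - 1) * q ^ (2 * (n : ℕ) - 1) / (1 - q ^ (4 * (n : ℕ) - 2)))
      (q * ramanujanPsi (q ^ 2) ^ 4) := by
    refine hasSum_pnat_of_succ (F := fun n : ℕ =>
      (2 * (n : ℂ) - 1) * q ^ (2 * n - 1) / (1 - q ^ (4 * n - 2))) ?_
    refine (hasSum_lambert_odd hq).congr_of_eq (fun n => ?_) rfl
    rw [show 2 * (n + 1) - 1 = 2 * n + 1 by omega, show 4 * (n + 1) - 2 = 4 * n + 2 by omega]
    push_cast
    ring
  have hb2 : HasSum (fun n : ℕ+ =>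
      6 * q ^ (8 * (n : ℕ) - 4) / (1 - q ^ (4 * (n : ℕ) - 2)) ^ 4
        + q ^ (4 * (n : ℕ) - 2) / (1 - q ^ (4 * (n : ℕ) - 2)) ^ 2)
      ((q * ramanujanPsi (q ^ 2) ^ 4) ^ 2) := by
    refine hasSum_pnat_of_succ (F := fun n : ℕ => 6 * q ^ (8 * n - 4) / (1 - q ^ (4 * n - 2)) ^ 4
        + q ^ (4 * n - 2) / (1 - q ^ (4 * n - 2)) ^ 2) ?_
    rw [← orbitSum_geomSeries₃_eq hq]
    refine (hasSum_orbitSum differentiableOn_geomSeries₃ geomSeries₃_zero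
      (norm_pow_lt_one hq four_ne_zero) (q ^ 2)).congr_of_eq (fun n => ?_) rfl
    have hlt := norm_pow_lt_one hq (by omega : 4 * n + 2 ≠ 0)
    have hne : 1 - q ^ (4 * n + 2) ≠ 0 := by
      intro h
      rw [← sub_eq_zero.1 h, norm_one] at hlt
      exact lt_irrefl _ hlt
    rw [show 8 * (n + 1) - 4 = (4 * n + 2) * 2 by omega, show 4 * (n + 1) - 2 = 4 * n + 2 by omega,
      show q ^ 2 * (q ^ 4) ^ n = q ^ (4 * n + 2) by ring, pow_mul, geomSeries₃]
    -- The summands agree because 6y² + y(1 − y)² = y(1 + 4y + y²).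
    generalize q ^ (4 * n + 2) = y at hne
    field_simp
    ring
  have hψ : ramanujanPsi (q ^ 3) ^ 3 / ramanujanPsi (q ^ 9) =
      1 + 3 * (orbitSum geomSeries₀ ((q ^ 3) ^ 6) (q ^ 3) -
        orbitSum geomSeries₀ ((q ^ 3) ^ 6) ((q ^ 3) ^ 5)) := by
    rw [show q ^ 9 = (q ^ 3) ^ 3 by ring]
    exact ramanujanPsi_cube_div hx
  refine ⟨⟨ha1.summable, ha2.summable, ?_, ?_⟩, hb1.summable, hb2.summable, ?_, ?_⟩
  · rw [ha1.tsum_eq, hψ]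
  · rw [ha2.tsum_eq, hψ, sq_one_add_lambert_eq hx]
  · rw [hb1.tsum_eq]
  · rw [hb2.tsum_eq]
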